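/- **Setting.** Let $\mathcal X\subset\mathbb R^d$ be finite, $\Omega\subset\mathbb R^m$, $w_1,\dots,w_n\in\Omega$ fixed samples, $S_n=\{w_1,\dots,w_n\}$, and let $k$ be a positive (semi)definite kernel on $\mathcal X\times\Omega$ with $k\le 1$. Let $\rho\ge 0$, $\sigma>0$, and let $\mathcal P$ be a non-empty finite subset of the $\chi^2$-ball $$\Big\{p\in\Delta_n : \tfrac12\sum_{i=1}^n\tfrac1n\,(n p_i-1)^2\le\rho\Big\}$$ of radius $\rho$ around the empirical distribution $(1/n,\dots,1/n)$, where $\Delta_n$ is the probability simplex in $\mathbb R^n$. For a function $h$ on $\mathcal X\times\Omega$ and a conditional distribution $P:\mathcal X\to\mathcal P$ put $g(h,x,P)=\sum_i P(w_i|x)\,h(x,w_i)$. The unknown function $f$ is drawn from the Gaussian process prior $GP(0,k)$. The DRBQO posterior-sampling policy does the following in each round $t=1,2,\dots$: it draws $\tilde f_t\sim GP(\mu_{t-1},C_{t-1})$ from the posterior given the observations made so far; it chooses $x_t\in\arg\max_{x\in\mathcal X}\min_{p\in\mathcal P}E_p[\tilde f_t(x,\cdot)]$ and $P_t(\cdot|x)\in\arg\min_{p\in\mathcal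 P}E_p[\tilde f_t(x,\cdot)]$ for every $x\in\mathcal X$; it chooses $w_t\in\arg\max_{w\in S_n}C_{t-1}(x_t,w;x_t,w)$; and it observes $y_t=f(x_t,w_t)+\epsilon_t$ with independent noise $\epsilon_t\sim N(0,\sigma^2)$. Ties are broken using only the past and $\tilde f_t$. With $x^*\in\arg\max_x\min_{p\in\mathcal P}E_p[f(x,\cdot)]$ and $P^*(\cdot|x)\in\arg\min_{p\in\mathcal P}E_p[f(x,\cdot)]$, the Bayesian regret is $$\mathrm{BayesRegret}(T)=\mathbb E\Big[\sum_{t=1}^T\mathbb E\big[g(f,x^*,P^*)-g(f,x_t,P_t)\,\big|\,f\big]\Big].$$ Let $\gamma_T$ be the maximum information gain, i.e. the maximum, over all choices (with repetition) of $T$ points $z_1,\dots,z_T$ of $\mathcal X\times S_n$, of the mutual information between $(f(z_i))_{i\le T}$ and the noisy observations $(f(z_i)+\epsilon_i)_{i\le T}$. Put $\beta_T=2\log\frac{(1+T^2)|\mathcal X||\mathcal P|}{\sqrt{2\pi}}$. **Theorem.** For every $B\ge 0$ and every $T\in\mathbb N$, the instantaneous regrets $g(f,x^*,P^*)-g(f,x_t,P_t)$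 are integrable and $$\mathrm{BayesRegret}(T)\le 1+\frac{(\sqrt{\beta_T}+B)\sqrt{2\pi}}{|\mathcal X||\mathcal P|}+\frac{2\gamma_T\sqrt{(1+2\rho)n}}{\log(1+\sigma^{-2})}+2\sqrt{\frac{T\gamma_T}{\log(1+\sigma^{-2})}\,\log\frac{(1+T^2)|\mathcal X||\mathcal P|}{\sqrt{2\pi}}}$$ (the square root of a negative number being read as $0$, which matters only if $(1+T^2)|\mathcal X||\mathcal P|<\sqrt{2\pi}$). Moreover the Bayesian regret is sublinear: for every $\delta>0$, $\mathrm{BayesRegret}(T)\le\delta T$ for all sufficiently large $T$. In particular this holds for linear kernels (normalised so that $k\le1$), squared exponential kernels and Matérn kernels. -/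

import Mathlib

open MeasureTheory ProbabilityTheory Filter Topology
open scoped Matrix ENNReal

namespace DRBQO

noncomputable section

/-! ### Setting

`𝒳` is a finite decision set in `ℝ^d`, `Ω ⊆ ℝ^m` is the context space, `w 0, …, w (n-1) ∈ Ω` are
the context samples, and objective functions are functions on `𝒳 × Ω`.  A probability distribution
on the samples is given by its vector of weights `p : Fin n → ℝ`. -/

/-- The domain `𝒳 × Ω` of the objective functions. -/
abbrev Dom {d m : ℕ} (𝒳 : Finset (EuclideanSpace ℝ (Fin d)))
    (Ω : Set (EuclideanSpace ℝ (Fin m))) : Type :=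
  𝒳 × Ω

/-- The `χ²`-divergence `D(p, q) = ½ ∑ᵢ (pᵢ / qᵢ - 1)² qᵢ = ½ ∫ (dp/dq - 1)² dq`
(used for a `q` with positive weights). -/
def chiSqDiv {n : ℕ} (p q : Fin n → ℝ) : ℝ :=
  (1 / 2) * ∑ i, (p i / q i - 1) ^ 2 * q i

/-- The `χ²`-ball of radius `ρ` around the empirical distribution `(1/n, …, 1/n)`,
inside the probability simplex. -/
def chiSqBall (n : ℕ) (ρ : ℝ) : Set (Fin n → ℝ) :=
  {p | p ∈ stdSimplex ℝ (Fin n) ∧ chiSqDiv p (fun _ => 1 / (n : ℝ)) ≤ ρ}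

section Objective

variable {d m n : ℕ} {𝒳 : Finset (EuclideanSpace ℝ (Fin d))} {Ω : Set (EuclideanSpace ℝ (Fin m))}

/-- The expectation `E_p[h(x, ·)]` for the distribution `p` on the samples. -/
def expect (w : Fin n → Ω) (h : Dom 𝒳 Ω → ℝ) (x : 𝒳) (p : Fin n → ℝ) : ℝ :=
  ∑ i, p i * h (x, w i)

/-- The quadrature functional `g(h, x, P) = E_{P(·|x)}[h(x, ·)]` for a conditional
distribution `P`. -/
def quadrature (w : Fin n → Ω) (h : Dom 𝒳 Ω → ℝ) (x : 𝒳) (P : 𝒳 → Fin n → ℝ) : ℝ :=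
  expect w h x (P x)

/-- The robust value `min_{p ∈ U} E_p[h(x, ·)]` of the decision `x`. -/
def robustValue (w : Fin n → Ω) (U : Finset (Fin n → ℝ)) (h : Dom 𝒳 Ω → ℝ) (x : 𝒳) : ℝ :=
  ⨅ p : U, expect w h x p

/-- `x ∈ argmax_{x} min_{p ∈ U} E_p[h(x, ·)]` and
`P(·|x') ∈ argmin_{p ∈ U} E_p[h(x', ·)]` for every `x'`. -/
structure IsRobustOptimal (w : Fin n → Ω) (U : Finset (Fin n → ℝ)) (h : Dom 𝒳 Ω → ℝ)
    (x : 𝒳) (P : 𝒳 → Fin n → ℝ) : Prop where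
  mem : ∀ x', P x' ∈ U
  argmin : ∀ x', ∀ p ∈ U, expect w h x' (P x') ≤ expect w h x' p
  argmax : ∀ x', robustValue w U h x' ≤ robustValue w U h x

end Objective

/-! ### Gaussian process regression -/

section GP

variable {Z : Type*}

/-- The Gram matrix of the kernel `k` at a family of points. -/
def gram (k : Z → Z → ℝ) {ι : Type*} (z : ι → Z) : Matrix ι ι ℝ :=
  Matrix.of fun a b => k (z a) (z b)

/-- Posterior mean at the point `u`, given the data `(z i, y i)`, `i < t`, under the prior
`GP(0, k)` and independent `N(0, σ²)` observation noise. -/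
def postMean (k : Z → Z → ℝ) (σ : ℝ) {t : ℕ} (z : Fin t → Z) (y : Fin t → ℝ) (u : Z) : ℝ :=
  (fun i => k (z i) u) ⬝ᵥ ((gram k z + σ ^ 2 • (1 : Matrix (Fin t) (Fin t) ℝ))⁻¹ *ᵥ y)

/-- Posterior covariance at the points `u`, `v`, given observations at `z i`, `i < t`. -/
def postCov (k : Z → Z → ℝ) (σ : ℝ) {t : ℕ} (z : Fin t → Z) (u v : Z) : ℝ :=
  k u v - (fun i => k (z i) u) ⬝ᵥ
    ((gram k z + σ ^ 2 • (1 : Matrix (Fin t) (Fin t) ℝ))⁻¹ *ᵥ fun i => k (z i) v)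

/-- The random function `f` is a Gaussian process `GP(0, k)` under `Pr`. -/
structure IsCenteredGP {S : Type*} [MeasurableSpace S] (Pr : Measure S) (f : Z → S → ℝ)
    (k : Z → Z → ℝ) : Prop where
  gaussian : IsGaussianProcess f Pr
  mean : ∀ u, ∫ s, f u s ∂Pr = 0
  cov : ∀ u v, covariance (f u) (f v) Pr = k u v

/-- Conditionally on the random variable `V`, the random function `F` is a Gaussian process with
the (random) mean function `μ` and covariance function `C`: the conditional law of each of its
finite-dimensional marginals given `V` is the corresponding Gaussian law. -/
def IsCondGP {S : Type*} [MeasurableSpace S] (Pr : Measure S) [IsFiniteMeasure Pr]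
    {W : Type*} [MeasurableSpace W] (V : S → W) (F : Z → S → ℝ)
    (μ : S → Z → ℝ) (C : S → Z → Z → ℝ) : Prop :=
  ∀ (ι : Type) [Fintype ι] [DecidableEq ι] (u : ι → Z),
    ∀ᵐ s ∂Pr, condDistrib (fun s' => WithLp.toLp 2 fun i => F (u i) s') V Pr (V s) =
      multivariateGaussian (WithLp.toLp 2 fun i => μ s (u i)) (gram (C s) u)

end GP

/-! ### Maximum information gain -/

/-- The mutual information of the two components of a joint law `ν`: the Kullback–Leibler
divergence of `ν` from the product of its marginals. -/
def mutualInfo {α β : Type*} [MeasurableSpace α] [MeasurableSpace β] (ν : Measure (α × β)) :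
    ℝ≥0∞ :=
  InformationTheory.klDiv ν (ν.fst.prod ν.snd)

/-- The joint law of `(f_z, y_z)`, where `f_z = (f(z_1), …, f(z_T))` for `f ∼ GP(0, k)`, and
`y_z = f_z + ε` with independent noise `ε ∼ N(0, σ² I)`. -/
def obsLaw {Z : Type*} (k : Z → Z → ℝ) (σ : ℝ) {T : ℕ} (z : Fin T → Z) :
    Measure (EuclideanSpace ℝ (Fin T) × (Fin T → ℝ)) :=
  ((multivariateGaussian 0 (gram k z)).prod
    (Measure.pi fun _ : Fin T => gaussianReal 0 (σ ^ 2).toNNReal)).map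
      fun p => (p.1, fun i => p.1 i + p.2 i)

/-- The maximum information gain `γ_T = max_z I(y_z; f_z)`, over all choices of `T` query points
(with repetitions) in `𝒳 × {w 0, …, w (n-1)}`. -/
def maxInfoGain {d m n : ℕ} {𝒳 : Finset (EuclideanSpace ℝ (Fin d))}
    {Ω : Set (EuclideanSpace ℝ (Fin m))} (w : Fin n → Ω)
    (k : Dom 𝒳 Ω → Dom 𝒳 Ω → ℝ) (σ : ℝ) (T : ℕ) : ℝ :=
  ⨆ a : Fin T → 𝒳 × Fin n, (mutualInfo (obsLaw k σ fun i => ((a i).1, w (a i).2))).toReal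

/-! ### The algorithm and its Bayesian regret -/

section Algorithm

variable {d m n : ℕ} {𝒳 : Finset (EuclideanSpace ℝ (Fin d))} {Ω : Set (EuclideanSpace ℝ (Fin m))}
  {S : Type*}

/-- Everything that happened in the rounds `i < t`: the decision `x i`, the index `j i` of the
sample queried, the observation `y i`, and the posterior sample `F i`. -/
def history (x : ℕ → S → 𝒳) (j : ℕ → S → Fin n) (y : ℕ → S → ℝ) (F : ℕ → Dom 𝒳 Ω → S → ℝ)
    (t : ℕ) (s : S) : Fin t → 𝒳 × Fin n × ℝ × (Dom 𝒳 Ω → ℝ) :=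
  fun i => (x i s, j i s, y i s, fun u => F i u s)

/-- The locations queried in the rounds `i < t`. -/
def queries (w : Fin n → Ω) (x : ℕ → S → 𝒳) (j : ℕ → S → Fin n) (t : ℕ) (s : S) :
    Fin t → Dom 𝒳 Ω :=
  fun i => (x i s, w (j i s))

/-- A run of DRBQO on the probability space `(S, Pr)`, with prior `f ∼ GP(0, k)`, noise variance
`σ²`, context samples `w` and uncertainty set `U`.  Rounds are numbered `t = 0, 1, 2, …`; before
round `t` there are `t` observations.  In round `t`, the algorithm draws a function `F t` from the
posterior given the data, then chooses `x t`, `P t` robustly optimal for `F t`, then queries the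
sample number `j t` of largest posterior variance and observes `y t = f (x t, w (j t)) + ε t`.
Ties are broken in any way that uses only the history and `F t`. -/
structure IsRun [MeasurableSpace S] (Pr : Measure S) [IsProbabilityMeasure Pr]
    (w : Fin n → Ω) (U : Finset (Fin n → ℝ)) (k : Dom 𝒳 Ω → Dom 𝒳 Ω → ℝ) (σ : ℝ)
    (f : Dom 𝒳 Ω → S → ℝ) (ε : ℕ → S → ℝ) (F : ℕ → Dom 𝒳 Ω → S → ℝ)
    (x : ℕ → S → 𝒳) (P : ℕ → S → 𝒳 → Fin n → ℝ) (j : ℕ → S → Fin n) (y : ℕ → S → ℝ) :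
    Prop where
  measurable_f : ∀ u, Measurable (f u)
  measurable_ε : ∀ t, Measurable (ε t)
  measurable_F : ∀ t u, Measurable (F t u)
  /-- The prior. -/
  prior : IsCenteredGP Pr f k
  /-- The noise is Gaussian. -/
  noise : ∀ t, HasLaw (ε t) (gaussianReal 0 (σ ^ 2).toNNReal) Pr
  /-- The noise is independent of the objective, the past, and the current posterior sample. -/
  noise_indep : ∀ t, IndepFun (ε t)
    (fun s => ((fun u => f u s), history x j y F t s, fun u => F t u s)) Pr
  /-- The observations. -/
  obs : ∀ t s, y t s = f (x t s, w (j t s)) s + ε t s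
  /-- Posterior sampling: given the past (and the objective `f`, about which the algorithm knows
  only the past observations), `F t` is drawn from the posterior Gaussian process. -/
  sample : ∀ t, IsCondGP Pr (fun s => ((fun u => f u s), history x j y F t s)) (F t)
    (fun s => postMean k σ (queries w x j t s) fun i => y i s)
    (fun s => postCov k σ (queries w x j t s))
  /-- The choices in round `t` are functions of the past and of the posterior sample. -/
  measurable_x : ∀ t, Measurable[MeasurableSpace.comap
    (fun s => (history x j y F t s, fun u => F t u s)) inferInstance] (x t)
  measurable_P : ∀ t, Measurable[MeasurableSpace.comap
    (fun s => (history x j y F t s, fun u => F t u s)) inferInstance] (P t)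
  measurable_j : ∀ t, Measurable[MeasurableSpace.comap
    (fun s => (history x j y F t s, fun u => F t u s)) inferInstance] (j t)
  /-- The surrogate distributionally robust optimization. -/
  choose_x : ∀ t s, IsRobustOptimal w U (fun u => F t u s) (x t s) (P t s)
  /-- The sample of highest posterior variance. -/
  choose_w : ∀ t s (i : Fin n),
    postCov k σ (queries w x j t s) (x t s, w i) (x t s, w i) ≤
      postCov k σ (queries w x j t s) (x t s, w (j t s)) (x t s, w (j t s))

/-- The instantaneous regret `g(f, x*, P*) - g(f, x_t, P_t)`. -/
def instRegret (w : Fin n → Ω) (f : Dom 𝒳 Ω → S → ℝ) (xs : S → 𝒳) (Ps : S → 𝒳 → Fin n → ℝ)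
    (x : ℕ → S → 𝒳) (P : ℕ → S → 𝒳 → Fin n → ℝ) (t : ℕ) (s : S) : ℝ :=
  quadrature w (fun u => f u s) (xs s) (Ps s) - quadrature w (fun u => f u s) (x t s) (P t s)

/-- The `T`-period regret `∑_t E[g(f, x*, P*) - g(f, x_t, P_t) | f]`. -/
def regret [MeasurableSpace S] (Pr : Measure S) (w : Fin n → Ω) (f : Dom 𝒳 Ω → S → ℝ)
    (xs : S → 𝒳) (Ps : S → 𝒳 → Fin n → ℝ) (x : ℕ → S → 𝒳) (P : ℕ → S → 𝒳 → Fin n → ℝ)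
    (T : ℕ) (s : S) : ℝ :=
  ∑ t ∈ Finset.range T, condExp (MeasurableSpace.comap (fun s' u => f u s') inferInstance) Pr
    (instRegret w f xs Ps x P t) s

/-- The `T`-period Bayesian regret: the expectation of the `T`-period regret. -/
def bayesRegret [MeasurableSpace S] (Pr : Measure S) (w : Fin n → Ω) (f : Dom 𝒳 Ω → S → ℝ)
    (xs : S → 𝒳) (Ps : S → 𝒳 → Fin n → ℝ) (x : ℕ → S → 𝒳) (P : ℕ → S → 𝒳 → Fin n → ℝ)
    (T : ℕ) : ℝ :=
  ∫ s, regret Pr w f xs Ps x P T s ∂Pr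

end Algorithm

end

end DRBQO

/-! The engine is probability matching. Given the history, the objective `f` and the posterior
sample `F t` have the same law at the finitely many sites, so their optimal robust values have the
same mean; moreover they are conditionally independent, so that choices made from `F t` average `f`
to its posterior mean. Hence the expected regret of round `t` is the expected excess of `F t` over
the posterior mean, averaged with the weights `P t` at `x t` (`integral_instRegret`).

Only |𝒳||U| pairs (x, p) exist. The excess is therefore at most `b` posterior standard deviations of
the averaged value, plus the sum over all pairs of the positive parts of what is left. Each positive
part has mean at most φ(b), with φ the standard normal density, because `k ≤ 1`. The variance of an
average is at most the largest variance entering it, and the algorithm queries the sample where the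
variance is largest; so the standard deviation in question is at most `queryStd`
(`integral_instRegret_le`).

It remains to bound the sum of `queryStd` along every path. For the explicit bound, the sum of log(1
+ σ⁻² queryStd²) is a log-determinant, namely twice the mutual information at the queried points.
With Cauchy–Schwarz and b = √(2 log A), A = (1 + T²)|𝒳||U|/√(2π), this gives 1 plus the last term of
the claimed bound; the other two terms are nonnegative. For sublinearity no growth rate of γ_T is
needed: after q observations at a site the posterior standard deviation there is at most σ/√q, and
there are finitely many sites, so the averages of `queryStd` tend to zero. This covers every
admissible kernel.

The delicate point is that a run prescribes only the law of `F t` given `f` and the history. That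
the posterior of `f` itself is the Gaussian process with `postMean` and `postCov` is proved by
induction on the round (`map_history_siteValues`): revealing `F t` does not change the law of `f`
given the history, the query is then determined, and one noisy observation acts by
`lintegral_noisy_observation`, which agrees with the rank-one recursions `postMean_succ` and
`postCov_succ`. -/

namespace DRBQO

/-! ### Linear algebra of the posterior mean and covariance -/

section Posterior

variable {Z : Type*} {k : Z → Z → ℝ} {σ : ℝ}

lemma kernel_symm (hk : (Matrix.of k).PosSemidef) (u v : Z) : k u v = k v u := by
  simpa using hk.isHermitian.apply v u

lemma gram_posSemidef (hk : (Matrix.of k).PosSemidef) {ι : Type*} (z : ι → Z) :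
    (gram k z).PosSemidef :=
  hk.submatrix z

lemma noisyGram_posDef (hk : (Matrix.of k).PosSemidef) (hσ : 0 < σ) {ι : Type*} [Fintype ι]
    [DecidableEq ι] (z : ι → Z) :
    (gram k z + σ ^ 2 • (1 : Matrix ι ι ℝ)).PosDef :=
  Matrix.PosDef.posSemidef_add (gram_posSemidef hk z) (Matrix.PosDef.one.smul (by positivity))

lemma isUnit_det_noisyGram (hk : (Matrix.of k).PosSemidef) (hσ : 0 < σ) {ι : Type*} [Fintype ι]
    [DecidableEq ι] (z : ι → Z) :
    IsUnit (gram k z + σ ^ 2 • (1 : Matrix ι ι ℝ)).det :=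
  (noisyGram_posDef hk hσ z).det_pos.ne'.isUnit

/-- The posterior covariance is the Schur complement of the noisy Gram block in the joint covariance
of the observations and the values at `u`. That joint covariance is a Gram matrix plus a nonnegative
diagonal, the noise entering on the observed block only. -/
lemma gram_postCov_posSemidef (hk : (Matrix.of k).PosSemidef) (hσ : 0 < σ) {t : ℕ}
    (z : Fin t → Z) {ι : Type*} [Finite ι] (u : ι → Z) :
    (gram (postCov k σ z) u).PosSemidef := by
  have := Fintype.ofFinite ι
  classical
  set M := gram k z + σ ^ 2 • (1 : Matrix (Fin t) (Fin t) ℝ) with hM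
  have hMd : M.PosDef := noisyGram_posDef hk hσ z
  have : Invertible M := M.invertibleOfIsUnitDet (isUnit_det_noisyGram hk hσ z)
  have h1 : (Matrix.fromBlocks M (Matrix.of fun i a => k (z i) (u a))
      (Matrix.of fun i a => k (z i) (u a))ᴴ (gram k u)).PosSemidef := by
    have e : Matrix.fromBlocks M (Matrix.of fun i a => k (z i) (u a))
        (Matrix.of fun i a => k (z i) (u a))ᴴ (gram k u) = gram k (Sum.elim z u) +
          Matrix.diagonal (Sum.elim (fun _ => σ ^ 2) (fun _ => 0)) := by
      ext i j
      rcases i with i | i <;> rcases j with j | j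
      · simp [hM, gram, Matrix.one_apply, Matrix.diagonal_apply]
      · simp [gram]
      · simp [gram, kernel_symm hk]
      · simp [gram, Matrix.diagonal_apply]
    rw [e]
    refine (gram_posSemidef hk _).add (Matrix.PosSemidef.diagonal ?_)
    intro i
    rcases i with i | i <;> simp [sq_nonneg]
  have h2 := (Matrix.PosDef.fromBlocks₁₁ _ _ hMd).1 h1
  convert! h2 using 1
  ext a b
  simp [gram, postCov, Matrix.mul_assoc, Matrix.mul_apply, dotProduct, Matrix.mulVec, hM]

lemma postCov_symm (hk : (Matrix.of k).PosSemidef) (hσ : 0 < σ) {t : ℕ} (z : Fin t → Z)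
    (u v : Z) : postCov k σ z u v = postCov k σ z v u := by
  simpa [gram] using ((gram_postCov_posSemidef hk hσ z ![u, v]).isHermitian.apply 1 0)

lemma postCov_self_nonneg (hk : (Matrix.of k).PosSemidef) (hσ : 0 < σ) {t : ℕ} (z : Fin t → Z)
    (u : Z) : 0 ≤ postCov k σ z u u := by
  simpa [gram] using (gram_postCov_posSemidef hk hσ z ![u]).diag_nonneg (i := 0)

/-- The posterior variance is the smallest mean squared error of a linear estimator. -/
lemma postCov_self_le (hk : (Matrix.of k).PosSemidef) (hσ : 0 < σ) {t : ℕ} (z : Fin t → Z)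
    (u : Z) (a : Fin t → ℝ) :
    postCov k σ z u u ≤ k u u - 2 * (a ⬝ᵥ fun i => k (z i) u) +
      a ⬝ᵥ ((gram k z + σ ^ 2 • (1 : Matrix (Fin t) (Fin t) ℝ)) *ᵥ a) := by
  set M := gram k z + σ ^ 2 • (1 : Matrix (Fin t) (Fin t) ℝ) with hM
  have hMd : M.PosDef := noisyGram_posDef hk hσ z
  have hu : IsUnit M.det := isUnit_det_noisyGram hk hσ z
  set b : Fin t → ℝ := fun i => k (z i) u with hb
  -- Completing the square: the optimal coefficients are `M⁻¹ *ᵥ b`, and the excess error of `a` is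
  -- the quadratic form of `M` at the difference.
  have h := hMd.posSemidef.dotProduct_mulVec_nonneg (a - M⁻¹ *ᵥ b)
  have hs : ∀ c d : Fin t → ℝ, c ⬝ᵥ M *ᵥ d = d ⬝ᵥ M *ᵥ c := fun c d => by
    rw [Matrix.dotProduct_mulVec, ← Matrix.mulVec_transpose, dotProduct_comm,
      show Mᵀ = M from by simpa using hMd.isHermitian.eq]
  have h3 : M *ᵥ (M⁻¹ *ᵥ b) = b := by
    rw [Matrix.mulVec_mulVec, Matrix.mul_nonsing_inv _ hu, Matrix.one_mulVec]
  simp only [star_trivial, Matrix.mulVec_sub, sub_dotProduct, dotProduct_sub, h3] at h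
  rw [hs (M⁻¹ *ᵥ b) a, h3, dotProduct_comm _ b] at h
  unfold postCov
  rw [← hM, ← hb, dotProduct_comm a b, dotProduct_comm b (M⁻¹ *ᵥ b)]
  linarith

lemma postCov_self_le_kernel (hk : (Matrix.of k).PosSemidef) (hσ : 0 < σ) {t : ℕ} (z : Fin t → Z)
    (u : Z) : postCov k σ z u u ≤ k u u := by
  simpa using postCov_self_le hk hσ z u 0

/-- After `m` noisy observations at `u`, the posterior variance at `u` is at most `σ² / m`. -/
lemma postCov_self_le_div (hk : (Matrix.of k).PosSemidef) (hσ : 0 < σ) {t : ℕ} (z : Fin t → Z)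
    (u : Z) (s : Finset (Fin t)) (hs : s.Nonempty) (hz : ∀ i ∈ s, z i = u) :
    postCov k σ z u u ≤ σ ^ 2 / s.card := by
  classical
  have hc : (s.card : ℝ) ≠ 0 := by simpa using hs.ne_empty
  -- The competing estimator is the plain average of the observations made at `u`; its error is the
  -- averaged noise, of variance σ²/m.
  refine (postCov_self_le hk hσ z u fun i => if i ∈ s then (s.card : ℝ)⁻¹ else 0).trans
    (le_of_eq ?_)
  have e1 : ((fun i => if i ∈ s then (s.card : ℝ)⁻¹ else 0) ⬝ᵥ fun i => k (z i) u) = k u u := by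
    simp only [dotProduct, ite_mul, zero_mul, Finset.sum_ite_mem, Finset.univ_inter]
    rw [Finset.sum_congr rfl fun i hi => by rw [hz i hi]]
    simp [hc]
  have e2 : ∀ i ∈ s, ((gram k z + σ ^ 2 • (1 : Matrix (Fin t) (Fin t) ℝ)) *ᵥ
      fun i => if i ∈ s then (s.card : ℝ)⁻¹ else 0) i = k u u + σ ^ 2 / s.card := by
    intro i hi
    simp only [Matrix.add_mulVec, Matrix.smul_mulVec, Matrix.one_mulVec, Pi.add_apply,
      Pi.smul_apply, hi, if_true, smul_eq_mul]
    congr 1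
    simp only [gram, Matrix.mulVec, dotProduct, Matrix.of_apply, mul_ite, mul_zero,
      Finset.sum_ite_mem, Finset.univ_inter]
    rw [Finset.sum_congr rfl fun j hj => by rw [hz j hj, hz i hi]]
    simp only [Finset.sum_const, nsmul_eq_mul]
    field_simp
  rw [e1]
  have e3 : ((fun i => if i ∈ s then (s.card : ℝ)⁻¹ else 0) ⬝ᵥ
      ((gram k z + σ ^ 2 • (1 : Matrix (Fin t) (Fin t) ℝ)) *ᵥ
      fun i => if i ∈ s then (s.card : ℝ)⁻¹ else 0)) = k u u + σ ^ 2 / s.card := by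
    rw [dotProduct]
    simp only [ite_mul, zero_mul, Finset.sum_ite_mem, Finset.univ_inter]
    rw [Finset.sum_congr rfl fun i hi => by rw [e2 i hi]]
    simp only [Finset.sum_const, nsmul_eq_mul]
    field_simp
  rw [e3]
  ring

/-- The bordered Gram matrix, in block form. -/
lemma noisyGram_succ_submatrix (hk : (Matrix.of k).PosSemidef) {t : ℕ} (z : Fin (t + 1) → Z) :
    (gram k z + σ ^ 2 • (1 : Matrix (Fin (t + 1)) (Fin (t + 1)) ℝ)).submatrix
      (finSumFinEquiv (m := t) (n := 1)) finSumFinEquiv =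
    Matrix.fromBlocks (gram k (fun i => z (Fin.castSucc i)) + σ ^ 2 • 1)
      (Matrix.of fun i _ => k (z (Fin.castSucc i)) (z (Fin.last t)))
      (Matrix.of fun _ i => k (z (Fin.castSucc i)) (z (Fin.last t)))
      (Matrix.of fun _ _ => k (z (Fin.last t)) (z (Fin.last t)) + σ ^ 2) := by
  have hl : ∀ i : Fin 1, Fin.natAdd t i = Fin.last t := fun i => by ext; simp
  have hn : ∀ i : Fin t, Fin.castAdd 1 i = Fin.castSucc i := fun i => rfl
  ext i j
  rcases i with i | i <;> rcases j with j | j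
  · simp [gram, hn, Matrix.one_apply]
  · simp [gram, hl, hn, (Fin.castSucc_lt_last i).ne]
  · simp [gram, hl, hn, (Fin.castSucc_lt_last j).ne', kernel_symm hk (z (Fin.last t))]
  · simp [gram, hl]

/-- Schur complement of the first `t` rows and columns: the remaining scalar is the conditional
variance of the next noisy observation. -/
lemma det_noisyGram_succ (hk : (Matrix.of k).PosSemidef) (hσ : 0 < σ) {t : ℕ}
    (z : Fin (t + 1) → Z) :
    (gram k z + σ ^ 2 • (1 : Matrix (Fin (t + 1)) (Fin (t + 1)) ℝ)).det =
      (gram k (fun i => z (Fin.castSucc i)) + σ ^ 2 • (1 : Matrix (Fin t) (Fin t) ℝ)).det *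
      (postCov k σ (fun i => z (Fin.castSucc i)) (z (Fin.last t)) (z (Fin.last t)) + σ ^ 2) := by
  have : Invertible (gram k (fun i => z (Fin.castSucc i)) +
      σ ^ 2 • (1 : Matrix (Fin t) (Fin t) ℝ)) :=
    Matrix.invertibleOfIsUnitDet _ (isUnit_det_noisyGram hk hσ _)
  rw [← Matrix.det_submatrix_equiv_self (finSumFinEquiv (m := t) (n := 1)),
    noisyGram_succ_submatrix hk, Matrix.det_fromBlocks₁₁]
  congr 1
  simp only [Matrix.invOf_eq_nonsing_inv, Matrix.det_unique, Matrix.mul_assoc, postCov]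
  simp only [Matrix.sub_apply, Matrix.of_apply, Matrix.mul_apply, dotProduct, Matrix.mulVec]
  ring

/-- The log-determinant of the noisy Gram matrix is the sum of the log posterior variances. -/
lemma log_det_noisyGram (hk : (Matrix.of k).PosSemidef) (hσ : 0 < σ) {T : ℕ} (z : ℕ → Z) :
    Real.log (gram k (fun i : Fin T => z i) + σ ^ 2 • (1 : Matrix (Fin T) (Fin T) ℝ)).det =
      T * Real.log (σ ^ 2) + ∑ t ∈ Finset.range T,
        Real.log (1 + σ⁻¹ ^ 2 * postCov k σ (fun i : Fin t => z i) (z t) (z t)) := by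
  induction T with
  | zero => simp
  | succ T ih =>
    have h0 := postCov_self_nonneg hk hσ (fun i : Fin T => z i) (z T)
    have hd := (noisyGram_posDef hk hσ fun i : Fin T => z i).det_pos
    rw [det_noisyGram_succ hk hσ, Finset.sum_range_succ]
    simp only [Fin.val_castSucc, Fin.val_last]
    rw [Real.log_mul hd.ne' (by positivity), ih]
    have : postCov k σ (fun i : Fin T => z i) (z T) (z T) + σ ^ 2 = σ ^ 2 * (1 + σ⁻¹ ^ 2 *
      postCov k σ (fun i : Fin T => z i) (z T) (z T)) := by
      field_simp; ring
    rw [this, Real.log_mul (by positivity) (by positivity)]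
    push_cast
    ring

/-- How a posterior quantity that is linear in the data changes with one more observation. -/
lemma dotProduct_noisyGram_succ_inv_mulVec (hk : (Matrix.of k).PosSemidef) (hσ : 0 < σ) {t : ℕ}
    (z : Fin (t + 1) → Z) (y : Fin (t + 1) → ℝ) (u : Z) :
    (fun i => k (z i) u) ⬝ᵥ
      ((gram k z + σ ^ 2 • (1 : Matrix (Fin (t + 1)) (Fin (t + 1)) ℝ))⁻¹ *ᵥ y) =
    postMean k σ (fun i => z (Fin.castSucc i)) (fun i => y (Fin.castSucc i)) u +
      (y (Fin.last t) - postMean k σ (fun i => z (Fin.castSucc i))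
        (fun i => y (Fin.castSucc i)) (z (Fin.last t))) /
      (postCov k σ (fun i => z (Fin.castSucc i)) (z (Fin.last t)) (z (Fin.last t)) + σ ^ 2) *
      postCov k σ (fun i => z (Fin.castSucc i)) u (z (Fin.last t)) := by
  set z' := fun i => z (Fin.castSucc i) with hz'
  set y' := fun i => y (Fin.castSucc i) with hy'
  set M := gram k z' + σ ^ 2 • (1 : Matrix (Fin t) (Fin t) ℝ) with hM
  set l := z (Fin.last t) with hl
  have hu : IsUnit M.det := isUnit_det_noisyGram hk hσ z'
  set s := postCov k σ z' l l + σ ^ 2 with hs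
  have hs0 : s ≠ 0 := by have := postCov_self_nonneg hk hσ z' l; positivity
  set α := M⁻¹ *ᵥ y' with hα
  set β := M⁻¹ *ᵥ fun i => k (z' i) l with hβ
  set r := (y (Fin.last t) - postMean k σ z' y' l) / s with hr
  have hMα : M *ᵥ α = y' := by
    rw [Matrix.mulVec_mulVec, Matrix.mul_nonsing_inv _ hu, Matrix.one_mulVec]
  have hMβ : M *ᵥ β = fun i => k (z' i) l := by
    rw [Matrix.mulVec_mulVec, Matrix.mul_nonsing_inv _ hu, Matrix.one_mulVec]
  -- The bordered system is solved explicitly. Its last coordinate `r` is the innovation divided by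
  -- its variance; the others are the old solution `α` corrected by `r • β`.
  have hsol : (gram k z + σ ^ 2 • (1 : Matrix (Fin (t + 1)) (Fin (t + 1)) ℝ)) *ᵥ
      Fin.snoc (α := fun _ => ℝ) (α - r • β) r = y := by
    have hrow : ∀ i : Fin t, ((gram k z + σ ^ 2 • (1 : Matrix (Fin (t + 1)) (Fin (t + 1)) ℝ)) *ᵥ
      Fin.snoc (α := fun _ => ℝ) (α - r • β) r) (Fin.castSucc i) =
        (M *ᵥ (α - r • β)) i + k (z' i) l * r := by
      intro i
      simp [Matrix.mulVec, dotProduct, Fin.sum_univ_castSucc, hM, gram, Matrix.one_apply,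
        (Fin.castSucc_lt_last i).ne, hz', hl]
    have hlast : ((gram k z + σ ^ 2 • (1 : Matrix (Fin (t + 1)) (Fin (t + 1)) ℝ)) *ᵥ
      Fin.snoc (α := fun _ => ℝ) (α - r • β) r) (Fin.last t) =
        (fun i => k (z' i) l) ⬝ᵥ (α - r • β) + (k l l + σ ^ 2) * r := by
      simp [Matrix.mulVec, dotProduct, Fin.sum_univ_castSucc, gram, Matrix.one_apply,
        (Fin.castSucc_lt_last _).ne', hz', hl, kernel_symm hk (z (Fin.last t))]
    ext i
    refine Fin.lastCases ?_ (fun i => ?_) i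
    · rw [hlast, dotProduct_sub, dotProduct_smul, smul_eq_mul]
      have e1 : (fun i => k (z' i) l) ⬝ᵥ α = postMean k σ z' y' l := rfl
      have e2 : s = k l l - (fun i => k (z' i) l) ⬝ᵥ β + σ ^ 2 := rfl
      have e3 : r * s = y (Fin.last t) - postMean k σ z' y' l := div_mul_cancel₀ _ hs0
      rw [e1]
      rw [e2] at e3
      linarith
    · rw [hrow, Matrix.mulVec_sub, Matrix.mulVec_smul, hMα, hMβ]
      simp [hy']
      ring
  have hinv : (gram k z + σ ^ 2 • (1 : Matrix (Fin (t + 1)) (Fin (t + 1)) ℝ))⁻¹ *ᵥ y =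
      Fin.snoc (α := fun _ => ℝ) (α - r • β) r := by
    rw [← hsol, Matrix.mulVec_mulVec,
      Matrix.nonsing_inv_mul _ (isUnit_det_noisyGram hk hσ z), Matrix.one_mulVec]
  rw [hinv]
  have e1 : postMean k σ z' y' u = (fun i => k (z' i) u) ⬝ᵥ α := rfl
  have e2 : postCov k σ z' u l = k u l - (fun i => k (z' i) u) ⬝ᵥ β := rfl
  have e3 : (fun i => k (z i) u) ⬝ᵥ Fin.snoc (α := fun _ => ℝ) (α - r • β) r =
      (fun i => k (z' i) u) ⬝ᵥ (α - r • β) + k u l * r := by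
    simp [dotProduct, Fin.sum_univ_castSucc, hz', hl, kernel_symm hk u]
  rw [e1, e2, e3, dotProduct_sub, dotProduct_smul, smul_eq_mul]
  ring

lemma postMean_succ (hk : (Matrix.of k).PosSemidef) (hσ : 0 < σ) {t : ℕ}
    (z : Fin (t + 1) → Z) (y : Fin (t + 1) → ℝ) (u : Z) :
    postMean k σ z y u =
    postMean k σ (fun i => z (Fin.castSucc i)) (fun i => y (Fin.castSucc i)) u +
      (y (Fin.last t) - postMean k σ (fun i => z (Fin.castSucc i))
        (fun i => y (Fin.castSucc i)) (z (Fin.last t))) /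
      (postCov k σ (fun i => z (Fin.castSucc i)) (z (Fin.last t)) (z (Fin.last t)) + σ ^ 2) *
      postCov k σ (fun i => z (Fin.castSucc i)) u (z (Fin.last t)) :=
  dotProduct_noisyGram_succ_inv_mulVec hk hσ z y u

/-- The term subtracted from `k u v` in `postCov` is a posterior mean for the artificial data `k (z
i) v`, so the recursion for the mean applies. The innovation of these data at the new point is again
a posterior covariance. -/
lemma postCov_succ (hk : (Matrix.of k).PosSemidef) (hσ : 0 < σ) {t : ℕ}
    (z : Fin (t + 1) → Z) (u v : Z) :
    postCov k σ z u v = postCov k σ (fun i => z (Fin.castSucc i)) u v -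
      postCov k σ (fun i => z (Fin.castSucc i)) u (z (Fin.last t)) *
      postCov k σ (fun i => z (Fin.castSucc i)) v (z (Fin.last t)) /
      (postCov k σ (fun i => z (Fin.castSucc i)) (z (Fin.last t)) (z (Fin.last t)) + σ ^ 2) := by
  have h := dotProduct_noisyGram_succ_inv_mulVec hk hσ z (fun i => k (z i) v) u
  have e : k (z (Fin.last t)) v - postMean k σ (fun i => z (Fin.castSucc i))
      (fun i => k (z (Fin.castSucc i)) v) (z (Fin.last t)) =
      postCov k σ (fun i => z (Fin.castSucc i)) v (z (Fin.last t)) := by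
    rw [postCov_symm hk hσ]; rfl
  rw [e] at h
  rw [postCov, h]
  have e2 : postCov k σ (fun i => z (Fin.castSucc i)) u v = k u v -
    postMean k σ (fun i => z (Fin.castSucc i)) (fun i => k (z (Fin.castSucc i)) v) u := rfl
  rw [e2]
  ring

end Posterior

/-! ### Gaussian vectors: conditioning, measurability, truncated means -/

section Gaussian

variable {ι : Type*} [Fintype ι] [DecidableEq ι]

/-- A Gaussian measure on a Euclidean space is determined by its mean and covariance matrix. -/
lemma eq_multivariateGaussian {μ : Measure (EuclideanSpace ℝ ι)} [IsGaussian μ]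
    {m : EuclideanSpace ℝ ι} {C : Matrix ι ι ℝ} (hC : C.PosSemidef)
    (hm : ∀ i, ∫ v, v i ∂μ = m i)
    (hc : ∀ i j, cov[fun v => v i, fun v => v j; μ] = C i j) :
    μ = multivariateGaussian m C := by
  apply IsGaussian.ext
  · simp only [id_eq, integral_id_multivariateGaussian]
    ext i
    rw [← hm i]
    exact ((EuclideanSpace.proj (𝕜 := ℝ) i).integral_comp_comm
      (IsGaussian.integrable_id (μ := μ))).symm
  · rw [← ContinuousLinearMap.toBilinForm_inj]
    refine LinearMap.BilinForm.ext_basis (EuclideanSpace.basisFun ι ℝ).toBasis fun i j ↦ ?_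
    rw [ContinuousLinearMap.toBilinForm_apply, ContinuousLinearMap.toBilinForm_apply,
      covarianceBilin_apply_eq_cov IsGaussian.memLp_two_id,
      covarianceBilin_multivariateGaussian hC]
    simpa [PiLp.inner_apply] using hc i j

lemma multivariateGaussian_add (m c : EuclideanSpace ℝ ι) (C : Matrix ι ι ℝ) :
    multivariateGaussian (m + c) C = (multivariateGaussian m C).map (fun v => v + c) := by
  rw [multivariateGaussian, multivariateGaussian, Measure.map_map (by fun_prop) (by fun_prop)]
  congr 1
  ext x
  simp [add_right_comm]

lemma integral_eval_multivariateGaussian (m : EuclideanSpace ℝ ι) (C : Matrix ι ι ℝ) (i : ι) :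
    ∫ v, v i ∂(multivariateGaussian m C) = m i := by
  have h := (EuclideanSpace.proj (𝕜 := ℝ) i).integral_comp_comm
    (IsGaussian.integrable_id (μ := multivariateGaussian m C))
  simpa using h

lemma memLp_eval_multivariateGaussian (m : EuclideanSpace ℝ ι) (C : Matrix ι ι ℝ) (i : ι) :
    MemLp (fun v : EuclideanSpace ℝ ι => v i) 2 (multivariateGaussian m C) :=
  IsGaussian.memLp_dual (multivariateGaussian m C) (EuclideanSpace.proj (𝕜 := ℝ) i) 2 (by simp)

/-- The law of a linear functional of a centred Gaussian vector. -/
lemma map_dotProduct_multivariateGaussian {C : Matrix ι ι ℝ} (hC : C.PosSemidef) (p : ι → ℝ) :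
    (multivariateGaussian 0 C).map (fun v => ∑ i, p i * v i) =
      gaussianReal 0 (p ⬝ᵥ (C *ᵥ p)).toNNReal := by
  set L : EuclideanSpace ℝ ι →L[ℝ] ℝ := ∑ i, p i • EuclideanSpace.proj (𝕜 := ℝ) i with hL
  have hLe : (fun v : EuclideanSpace ℝ ι => ∑ i, p i * v i) = L := by
    ext v; simp [hL]
  rw [hLe, IsGaussian.map_eq_gaussianReal]
  congr 2
  · rw [L.integral_comp_id_comm IsGaussian.integrable_id]; simp
  · have h := covarianceBilin_self (IsGaussian.memLp_two_id (μ := multivariateGaussian 0 C))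
      (WithLp.toLp 2 p)
    rw [covarianceBilin_multivariateGaussian hC] at h
    rw [h, ← hLe]
    congr 1
    ext v
    simp [PiLp.inner_apply, mul_comm]

/-- Conditioning a Gaussian vector on a noisy observation of one coordinate. -/
lemma lintegral_noisy_observation {m : EuclideanSpace ℝ ι} {C C' : Matrix ι ι ℝ}
    (hC : C.PosSemidef) (hC' : C'.PosSemidef) (z : ι) {τ : NNReal} (hτ : τ ≠ 0)
    (h : ∀ i j, C' i j = C i j - C i z * C j z / (C z z + τ))
    {Φ : ℝ × EuclideanSpace ℝ ι → ℝ≥0∞} (hΦ : Measurable Φ) :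
    ∫⁻ p, Φ (p.1 z + p.2, p.1) ∂((multivariateGaussian m C).prod (gaussianReal 0 τ)) =
      ∫⁻ p, ∫⁻ v, Φ (p.1 z + p.2, v) ∂(multivariateGaussian
        (m + WithLp.toLp 2 fun i => (p.1 z + p.2 - m z) / (C z z + τ) * C i z) C')
        ∂((multivariateGaussian m C).prod (gaussianReal 0 τ)) := by
  set Q := (multivariateGaussian m C).prod (gaussianReal 0 τ) with hQ
  set s : ℝ := C z z + τ with hs
  have hs0 : s ≠ 0 := by
    have := hC.diag_nonneg (i := z)
    have : (0 : ℝ) < τ := by positivity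
    positivity
  set A : ι → EuclideanSpace ℝ ι × ℝ → ℝ := fun i p => p.1 i with hA
  set e : EuclideanSpace ℝ ι × ℝ → ℝ := fun p => p.2 with he
  have hAm : ∀ i, MemLp (A i) 2 Q := fun i =>
    (memLp_eval_multivariateGaussian m C i).comp_measurePreserving measurePreserving_fst
  have hem : MemLp e 2 Q :=
    (memLp_id_gaussianReal' 2 (by simp)).comp_measurePreserving measurePreserving_snd
  have hAA : ∀ i j, cov[A i, A j; Q] = C i j := fun i j => by
    rw [← covariance_eval_multivariateGaussian (μ := m) hC i j,
      ← (measurePreserving_fst (μ := multivariateGaussian m C) (ν := gaussianReal 0 τ)).map_eq,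
      covariance_map_fun] <;> first | rfl | fun_prop
  have hAe : ∀ i, cov[A i, e; Q] = 0 := fun i => by
    exact covariance_fst_snd_prod (memLp_eval_multivariateGaussian m C i)
      (memLp_id_gaussianReal' (μ := 0) (v := τ) 2 (by simp))
  have hee : cov[e, e; Q] = τ := by
    have h1 : cov[id, id; gaussianReal 0 τ] = τ := by
      rw [covariance_self aemeasurable_id, variance_id_gaussianReal]
    rw [← h1, ← (measurePreserving_snd (μ := multivariateGaussian m C)
      (ν := gaussianReal 0 τ)).map_eq, covariance_map_fun] <;> first | rfl | fun_prop
  set Y : EuclideanSpace ℝ ι × ℝ → ℝ := fun p => A z p + e p with hY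
  -- `R` is the residual after regressing the coordinates on the observation `Y`. It is uncorrelated
  -- with `Y` and has covariance `C'`.
  set R : ι → EuclideanSpace ℝ ι × ℝ → ℝ := fun j p => A j p - C j z / s * Y p with hR
  have hYm : MemLp Y 2 Q := (hAm z).add hem
  have hRm : ∀ j, MemLp (R j) 2 Q := fun j => (hAm j).sub (hYm.const_mul _)
  have hsymm : ∀ i j, C i j = C j i := fun i j => by simpa using (hC.isHermitian.apply i j).symm
  have hAY : ∀ j, cov[A j, Y; Q] = C j z := fun j => by
    rw [show Y = A z + e from rfl, covariance_add_right (hAm j) (hAm z) hem, hAA, hAe, add_zero]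
  have hYA : ∀ j, cov[Y, A j; Q] = C j z := fun j => by rw [covariance_comm, hAY]
  have hYY : cov[Y, Y; Q] = s := by
    nth_rw 2 [show Y = A z + e from rfl]
    rw [covariance_add_right hYm (hAm z) hem, hYA, show Y = A z + e from rfl,
      covariance_add_left (hAm z) hem hem, hAe, hee, zero_add]
  have hYR : ∀ j, cov[Y, R j; Q] = 0 := fun j => by
    rw [hR]
    simp only
    rw [covariance_fun_sub_right hYm (hAm j) (hYm.const_mul _), covariance_const_mul_right, hYA,
      hYY]
    field_simp
    ring
  have hRR : ∀ i j, cov[R i, R j; Q] = C' i j := fun i j => by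
    rw [show R j = fun p => A j p - C j z / s * Y p from rfl,
      covariance_fun_sub_right (hRm i) (hAm j) (hYm.const_mul _), covariance_const_mul_right,
      covariance_comm (R i) Y, hYR, mul_zero, sub_zero, hR]
    simp only
    rw [covariance_fun_sub_left (hAm i) (hYm.const_mul _) (hAm j), covariance_const_mul_left, hYA,
      hAA, h]
    ring
  have hAint : ∀ i, ∫ p, A i p ∂Q = m i := fun i => by
    rw [← integral_eval_multivariateGaussian m C i]
    rw [← (measurePreserving_fst (μ := multivariateGaussian m C) (ν := gaussianReal 0 τ)).map_eq,
      integral_map (by fun_prop) (by fun_prop)]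
  have hYint : ∫ p, Y p ∂Q = m z := by
    have h0 : ∫ p, e p ∂Q = 0 := by
      rw [← integral_id_gaussianReal (μ := 0) (v := τ),
        ← (measurePreserving_snd (μ := multivariateGaussian m C) (ν := gaussianReal 0 τ)).map_eq,
        integral_map (by fun_prop) (by fun_prop)]
    rw [integral_add ((hAm z).integrable (by simp)) (hem.integrable (by simp)), hAint, h0,
      add_zero]
  let LY : EuclideanSpace ℝ ι × ℝ →L[ℝ] ℝ :=
    (EuclideanSpace.proj (𝕜 := ℝ) z).comp (ContinuousLinearMap.fst ℝ _ _) +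
      ContinuousLinearMap.snd ℝ _ _
  let LR : ι → EuclideanSpace ℝ ι × ℝ →L[ℝ] ℝ := fun j =>
    (EuclideanSpace.proj (𝕜 := ℝ) j).comp (ContinuousLinearMap.fst ℝ _ _) - (C j z / s) • LY
  -- `Y` and `R` are linear images of one Gaussian vector, so vanishing covariance gives
  -- independence. The conditional law given `Y` is then the law of `R` translated by the regression
  -- on `Y`.
  have hG : HasGaussianLaw (fun p => (fun _ : Unit => Y p, fun j => R j p)) Q :=
    (IsGaussian.hasGaussianLaw_id (μ := Q)).map_fun
      ((ContinuousLinearMap.pi fun _ : Unit => LY).prod (ContinuousLinearMap.pi LR))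
  have hind := hG.indepFun_of_covariance_eval (X := fun _ => Y) (fun _ j => hYR j)
  have hind2 : IndepFun Y (fun p => WithLp.toLp 2 fun j => R j p) Q :=
    hind.comp (φ := fun f : Unit → ℝ => f ()) (ψ := WithLp.toLp 2)
      (measurable_pi_apply ()) (by fun_prop)
  have hYmeas : Measurable Y := by fun_prop
  have hRmeas : Measurable fun p => WithLp.toLp 2 fun j => R j p := by fun_prop
  have hRlaw : Q.map (fun p => WithLp.toLp 2 fun j => R j p) =
      multivariateGaussian (WithLp.toLp 2 fun j => m j - C j z / s * m z) C' := by
    have : IsGaussian (Q.map (fun p => WithLp.toLp 2 fun j => R j p)) :=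
      (hG.snd.toLp_pi 2).isGaussian_map
    refine eq_multivariateGaussian hC' (fun i => ?_) fun i j => ?_
    · rw [integral_map hRmeas.aemeasurable (by fun_prop)]
      simp only
      rw [show R i = fun p => A i p - C i z / s * Y p from rfl,
        integral_sub ((hAm i).integrable (by simp)) ((hYm.const_mul _).integrable (by simp)),
        integral_const_mul, hAint, hYint]
    · rw [covariance_map_fun (by fun_prop) (by fun_prop) hRmeas.aemeasurable]
      exact hRR i j
  have hjoint := (indepFun_iff_map_prod_eq_prod_map_map hYmeas.aemeasurable
    hRmeas.aemeasurable).1 hind2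
  have hΨ : Measurable fun q : ℝ × EuclideanSpace ℝ ι =>
      Φ (q.1, q.2 + WithLp.toLp 2 fun j => C j z / s * q.1) := by fun_prop
  calc ∫⁻ p, Φ (p.1 z + p.2, p.1) ∂Q
      = ∫⁻ q, Φ (q.1, q.2 + WithLp.toLp 2 fun j => C j z / s * q.1)
          ∂(Q.map fun p => (Y p, WithLp.toLp 2 fun j => R j p)) := by
        rw [lintegral_map hΨ (hYmeas.prodMk hRmeas)]
        refine lintegral_congr fun p => ?_
        congr 2
        ext j
        simp [hR, hA]
    _ = ∫⁻ r, ∫⁻ v, Φ (r, v + WithLp.toLp 2 fun j => C j z / s * r) ∂(multivariateGaussian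
          (WithLp.toLp 2 fun j => m j - C j z / s * m z) C') ∂(Q.map Y) := by
        rw [hjoint, lintegral_prod _ hΨ.aemeasurable, hRlaw]
    _ = _ := by
        rw [lintegral_map (Measurable.lintegral_prod_right' (f := fun q =>
          Φ (q.1, q.2 + WithLp.toLp 2 fun j => C j z / s * q.1)) hΨ) hYmeas]
        refine lintegral_congr fun p => ?_
        have e : (m + WithLp.toLp 2 fun i => (p.1 z + p.2 - m z) / s * C i z) =
            (WithLp.toLp 2 fun j => m j - C j z / s * m z) +
              WithLp.toLp 2 fun j => C j z / s * Y p := by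
          ext j
          simp [hY, hA, he]
          ring
        rw [e, multivariateGaussian_add, lintegral_map (by fun_prop) (by fun_prop)]

open scoped MatrixOrder in
/-- A random choice of mean and covariance, the covariance taking finitely many values, gives a
Gaussian kernel. -/
lemma measurable_multivariateGaussian {α β : Type*} [MeasurableSpace α] [MeasurableSpace β]
    [Countable β] [MeasurableSingletonClass β]
    {m : α → EuclideanSpace ℝ ι} (hm : Measurable m) {b : α → β} (hb : Measurable b)
    (C : β → Matrix ι ι ℝ) :
    Measurable fun a => multivariateGaussian (m a) (C (b a)) := by
  -- Every multivariate Gaussian is an affine image of the standard one. As the covariance ranges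
  -- over a countable index type, no measurability of the matrix square root is required.
  obtain ⟨L, hL⟩ : ∃ L : β → (EuclideanSpace ℝ ι →L[ℝ] EuclideanSpace ℝ ι), ∀ a,
      multivariateGaussian (m a) (C (b a)) =
        (stdGaussian (EuclideanSpace ℝ ι)).map fun x => m a + L (b a) x :=
    ⟨fun c => Matrix.toEuclideanCLM (𝕜 := ℝ) (CFC.sqrt (C c)), fun a => rfl⟩
  refine Measure.measurable_of_measurable_coe _ fun s hs => ?_
  have hL' : Measurable fun q : β × EuclideanSpace ℝ ι => L q.1 q.2 :=
    measurable_from_prod_countable_right fun c => (L c).continuous.measurable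
  have hF : Measurable fun q : α × EuclideanSpace ℝ ι => m q.1 + L (b q.1) q.2 :=
    (hm.comp measurable_fst).add
      (hL'.comp ((hb.comp measurable_fst).prodMk measurable_snd))
  have h2 := measurable_measure_prodMk_left (ν := stdGaussian (EuclideanSpace ℝ ι)) (hF hs)
  convert! h2 using 2 with a
  rw [hL, Measure.map_apply (by fun_prop) hs]
  rfl

/-- `E[(Z - a)⁺] ≤ φ(a)` for a standard Gaussian `Z`. -/
lemma integral_posPart_sub_gaussianReal_le {a : ℝ} (ha : 0 ≤ a) :
    ∫ x, max (x - a) 0 ∂(gaussianReal 0 1) ≤ Real.exp (-a ^ 2 / 2) / √(2 * Real.pi) := by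
  -- The antiderivative that makes the Gaussian first moment on `(a, ∞)` explicit.
  have hderiv : ∀ x : ℝ, HasDerivAt (fun x => -Real.exp (-x ^ 2 / 2))
      (x * Real.exp (-x ^ 2 / 2)) x := by
    intro x
    have h1 : HasDerivAt (fun x : ℝ => -x ^ 2 / 2) (-x) x := by
      convert! ((hasDerivAt_pow 2 x).neg.div_const 2) using 1
      simp; ring
    convert! h1.exp.neg using 1
    ring
  have hlim : Tendsto (fun x : ℝ => -Real.exp (-x ^ 2 / 2)) atTop (𝓝 0) := by
    rw [← neg_zero]
    refine (Real.tendsto_exp_atBot.comp ?_).neg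
    have : Tendsto (fun x : ℝ => x ^ 2 / 2) atTop atTop :=
      (tendsto_pow_atTop two_ne_zero).atTop_div_const two_pos
    convert! tendsto_neg_atTop_atBot.comp this using 1
    ext x; simp; ring
  have hpos : ∀ x ∈ Set.Ioi a, 0 ≤ x * Real.exp (-x ^ 2 / 2) := fun x hx =>
    mul_nonneg (ha.trans (le_of_lt hx)) (Real.exp_nonneg _)
  have hint := integrableOn_Ioi_deriv_of_nonneg' (fun x _ => hderiv x) hpos hlim
  have hval := integral_Ioi_of_hasDerivAt_of_tendsto' (fun x _ => hderiv x) hint hlim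
  have hid : Integrable (fun x : ℝ => max (x - a) 0) (gaussianReal 0 1) := by
    have : Integrable (fun x : ℝ => x) (gaussianReal 0 1) :=
      (memLp_id_gaussianReal' 1 (by simp)).integrable (by simp)
    exact (this.sub (integrable_const a)).pos_part
  rw [integral_gaussianReal_eq_integral_smul one_ne_zero]
  -- Since `a ≥ 0`, the factor `x - a` may be enlarged to `x`, whose tail integral against the
  -- density is exactly φ(a).
  calc ∫ x, gaussianPDFReal 0 1 x • max (x - a) 0
      ≤ ∫ x, (Set.Ioi a).indicator
          (fun x => (√(2 * Real.pi))⁻¹ * (x * Real.exp (-x ^ 2 / 2))) x := by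
        refine integral_mono_of_nonneg (Eventually.of_forall fun x => ?_) ?_
          (Eventually.of_forall fun x => ?_)
        · exact smul_nonneg (gaussianPDFReal_nonneg _ _ _) (le_max_right _ _)
        · exact (integrable_indicator_iff measurableSet_Ioi).2 (hint.const_mul _)
        · by_cases hx : a < x
          · simp only [Set.mem_Ioi, hx, Set.indicator_of_mem, gaussianPDFReal, smul_eq_mul,
              NNReal.coe_one, mul_one, sub_zero, max_eq_left (sub_nonneg.2 hx.le)]
            rw [mul_assoc, mul_comm (Real.exp _)]
            gcongr
            linarith
          · simp [hx, max_eq_right (sub_nonpos.2 (not_lt.1 hx))]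
    _ = Real.exp (-a ^ 2 / 2) / √(2 * Real.pi) := by
        rw [integral_indicator measurableSet_Ioi, integral_const_mul, hval]
        ring

/-- `E[(X - a s)⁺] ≤ s φ(a)` for a centred Gaussian `X` of standard deviation `s`. -/
lemma integral_posPart_sub_mul_gaussianReal_le {a s : ℝ} (ha : 0 ≤ a) (hs : 0 ≤ s) :
    ∫ x, max (x - a * s) 0 ∂(gaussianReal 0 (s ^ 2).toNNReal) ≤
      s * (Real.exp (-a ^ 2 / 2) / √(2 * Real.pi)) := by
  have h : gaussianReal 0 (s ^ 2).toNNReal = (gaussianReal 0 1).map (s * ·) := by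
    rw [gaussianReal_map_const_mul]
    congr 1
    · simp
    · ext; simp [sq_nonneg]
  rw [h, integral_map (by fun_prop) (by fun_prop)]
  have e : ∀ x : ℝ, max (s * x - a * s) 0 = s * max (x - a) 0 := fun x => by
    rw [mul_max_of_nonneg _ _ hs]; ring_nf
  simp_rw [e]
  rw [integral_const_mul]
  exact mul_le_mul_of_nonneg_left (integral_posPart_sub_gaussianReal_le ha) hs

end Gaussian

/-! ### The posterior as a Markov kernel on histories -/

section Posterior

variable {d m n : ℕ} {𝒳 : Finset (EuclideanSpace ℝ (Fin d))} {Ω : Set (EuclideanSpace ℝ (Fin m))}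

/-- The type of the histories of the rounds `i < t`. -/
abbrev Hist (𝒳 : Finset (EuclideanSpace ℝ (Fin d))) (Ω : Set (EuclideanSpace ℝ (Fin m)))
    (n t : ℕ) : Type :=
  Fin t → 𝒳 × Fin n × ℝ × (Dom 𝒳 Ω → ℝ)

/-- The locations queried in a history. -/
def histQueries (w : Fin n → Ω) {t : ℕ} (h : Hist 𝒳 Ω n t) : Fin t → Dom 𝒳 Ω :=
  fun i => ((h i).1, w (h i).2.1)

/-- The observations made in a history. -/
def histObs {t : ℕ} (h : Hist 𝒳 Ω n t) : Fin t → ℝ :=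
  fun i => (h i).2.2.1

/-- The posterior mean at finitely many points. -/
noncomputable def postMeanVec (w : Fin n → Ω) (k : Dom 𝒳 Ω → Dom 𝒳 Ω → ℝ) (σ : ℝ) {t : ℕ}
    {ι : Type*} (u : ι → Dom 𝒳 Ω) (h : Hist 𝒳 Ω n t) : EuclideanSpace ℝ ι :=
  WithLp.toLp 2 fun i => postMean k σ (histQueries w h) (histObs h) (u i)

variable (w : Fin n → Ω) (k : Dom 𝒳 Ω → Dom 𝒳 Ω → ℝ) (σ : ℝ)

/-- The matrix inverse depends only on the query locations, which take countably many values; for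
fixed locations the mean is continuous in the observations. -/
lemma measurable_postMeanVec {t : ℕ} {ι : Type*} (u : ι → Dom 𝒳 Ω) :
    Measurable (postMeanVec w k σ u : Hist 𝒳 Ω n t → EuclideanSpace ℝ ι) := by
  refine (WithLp.measurable_toLp 2 _).comp (measurable_pi_iff.2 fun i => ?_)
  have h1 : Measurable fun q : (Fin t → 𝒳 × Fin n) × (Fin t → ℝ) =>
      postMean k σ (fun l => ((q.1 l).1, w (q.1 l).2)) q.2 (u i) := by
    refine measurable_from_prod_countable_right fun c => ?_
    set z : Fin t → Dom 𝒳 Ω := fun l => ((c l).1, w (c l).2)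
    exact Continuous.measurable (by
      change Continuous fun y => postMean k σ z y (u i)
      unfold postMean
      fun_prop)
  have h2 : Measurable fun h : Hist 𝒳 Ω n t =>
      ((fun l => ((h l).1, (h l).2.1), histObs h) : (Fin t → 𝒳 × Fin n) × (Fin t → ℝ)) := by
    unfold histObs
    fun_prop
  exact h1.comp h2

/-- The posterior law of the values of the objective at finitely many points. -/
noncomputable def postKernel {t : ℕ} {ι : Type*} [Fintype ι] [DecidableEq ι] (u : ι → Dom 𝒳 Ω) :
    Kernel (Hist 𝒳 Ω n t) (EuclideanSpace ℝ ι) where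
  toFun h := multivariateGaussian (postMeanVec w k σ u h)
    (gram (postCov k σ (histQueries w h)) u)
  measurable' :=
    measurable_multivariateGaussian (measurable_postMeanVec w k σ u)
      (b := fun h l => ((h l).1, (h l).2.1)) (by fun_prop)
      (fun q : Fin t → 𝒳 × Fin n => gram (postCov k σ fun l => ((q l).1, w (q l).2)) u)

instance {t : ℕ} {ι : Type*} [Fintype ι] [DecidableEq ι] (u : ι → Dom 𝒳 Ω) :
    IsMarkovKernel (postKernel w k σ (t := t) u) :=
  ⟨fun h => by
    change IsProbabilityMeasure (multivariateGaussian _ _)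
    infer_instance⟩

lemma postKernel_apply {t : ℕ} {ι : Type*} [Fintype ι] [DecidableEq ι] (u : ι → Dom 𝒳 Ω)
    (h : Hist 𝒳 Ω n t) : postKernel w k σ u h = multivariateGaussian (postMeanVec w k σ u h)
      (gram (postCov k σ (histQueries w h)) u) := rfl

/-- The points of the domain at which queries can be made. -/
def site : 𝒳 × Fin n → Dom 𝒳 Ω := fun a => (a.1, w a.2)

/-- The values of a random function at the sites. -/
def siteValues {S : Type*} (f : Dom 𝒳 Ω → S → ℝ) (s : S) : EuclideanSpace ℝ (𝒳 × Fin n) :=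
  WithLp.toLp 2 fun a => f (site w a) s

end Posterior

section Indicator

variable {α β γ δ : Type*} (a : α → β) (b : α → γ) (c : α → δ) (A : Set β) (B : Set γ) (C : Set δ)

/-- Together with `indicator_preimage_inter₃`, this rewrites integrals over events as integrals of
products, to which the disintegration formulas apply. -/
lemma indicator_preimage_inter₂ (g : α → ℝ≥0∞) (s : α) :
    (c ⁻¹' C ∩ a ⁻¹' A).indicator g s = A.indicator 1 (a s) * g s * C.indicator 1 (c s) := by
  by_cases h1 : a s ∈ A <;> by_cases h2 : c s ∈ C <;> simp [h1, h2]

lemma indicator_preimage_inter₃ (s : α) :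
    (c ⁻¹' C ∩ (a ⁻¹' A ∩ b ⁻¹' B)).indicator (1 : α → ℝ≥0∞) s =
      A.indicator 1 (a s) * B.indicator 1 (b s) * C.indicator 1 (c s) := by
  by_cases h1 : a s ∈ A <;> by_cases h2 : b s ∈ B <;> by_cases h3 : c s ∈ C <;> simp [h1, h2, h3]

end Indicator

/-! ### Conditional independence of the objective and the posterior sample -/

section Run

variable {d m n : ℕ} {𝒳 : Finset (EuclideanSpace ℝ (Fin d))} {Ω : Set (EuclideanSpace ℝ (Fin m))}
  {w : Fin n → Ω} {k : Dom 𝒳 Ω → Dom 𝒳 Ω → ℝ} {σ : ℝ} {U : Finset (Fin n → ℝ)}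
  {S : Type*} [MeasurableSpace S] {Pr : Measure S} [IsProbabilityMeasure Pr]
  {f : Dom 𝒳 Ω → S → ℝ} {ε : ℕ → S → ℝ} {F : ℕ → Dom 𝒳 Ω → S → ℝ}
  {x : ℕ → S → 𝒳} {P : ℕ → S → 𝒳 → Fin n → ℝ} {j : ℕ → S → Fin n} {y : ℕ → S → ℝ}

lemma measurable_siteValues {f : Dom 𝒳 Ω → S → ℝ} (hf : ∀ u, Measurable (f u)) :
    Measurable (siteValues w f) :=
  (WithLp.measurable_toLp 2 _).comp (measurable_pi_iff.2 fun _ => hf _)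

namespace IsRun

lemma measurable_sample (hrun : IsRun Pr w U k σ f ε F x P j y) (t : ℕ) :
    Measurable fun s u => F t u s :=
  measurable_pi_iff.2 (hrun.measurable_F t)

lemma measurable_objective (hrun : IsRun Pr w U k σ f ε F x P j y) :
    Measurable fun s u => f u s :=
  measurable_pi_iff.2 hrun.measurable_f

/-- The choices of a round are measurable in the earlier history and the sample. The observation is
measurable because `f` is evaluated at a random point among countably many sites. -/
lemma measurable_history (hrun : IsRun Pr w U k σ f ε F x P j y) (t : ℕ) :
    Measurable (history x j y F t) := by
  induction t with
  | zero => exact measurable_pi_iff.2 fun i => i.elim0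
  | succ t ih =>
    have hHF := ih.prodMk (hrun.measurable_sample t)
    have hx : Measurable (x t) := (hrun.measurable_x t).mono hHF.comap_le le_rfl
    have hj : Measurable (j t) := (hrun.measurable_j t).mono hHF.comap_le le_rfl
    have hy : Measurable (y t) := by
      have h1 : Measurable fun q : (𝒳 × Fin n) × S => f (site w q.1) q.2 :=
        measurable_from_prod_countable_right fun c => hrun.measurable_f (site w c)
      have h2 := (h1.comp ((hx.prodMk hj).prodMk measurable_id)).add (hrun.measurable_ε t)
      convert! h2 using 1
      ext s
      exact hrun.obs t s
    refine measurable_pi_iff.2 fun i => Fin.lastCases ?_ (fun i => ?_) i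
    · exact hx.prodMk (hj.prodMk (hy.prodMk (hrun.measurable_sample t)))
    · exact (measurable_pi_apply i).comp ih

lemma measurable_history_sample (hrun : IsRun Pr w U k σ f ε F x P j y) (t : ℕ) :
    Measurable fun s => (history x j y F t s, fun u => F t u s) :=
  (hrun.measurable_history t).prodMk (hrun.measurable_sample t)

/-- The objective, the history and finitely many values of the posterior sample. -/
lemma lintegral_sample (hrun : IsRun Pr w U k σ f ε F x P j y) (t : ℕ) {ι : Type} [Fintype ι]
    [DecidableEq ι] (u : ι → Dom 𝒳 Ω)
    {Φ : ((Dom 𝒳 Ω → ℝ) × Hist 𝒳 Ω n t) × EuclideanSpace ℝ ι → ℝ≥0∞} (hΦ : Measurable Φ) :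
    ∫⁻ s, Φ ((fun u => f u s, history x j y F t s), WithLp.toLp 2 fun i => F t (u i) s) ∂Pr =
      ∫⁻ s, ∫⁻ v, Φ ((fun u => f u s, history x j y F t s), v)
        ∂(postKernel w k σ u (history x j y F t s)) ∂Pr := by
  have hV : Measurable fun s => ((fun u => f u s, history x j y F t s) :
      (Dom 𝒳 Ω → ℝ) × Hist 𝒳 Ω n t) := hrun.measurable_objective.prodMk (hrun.measurable_history t)
  have hF : Measurable fun s => (WithLp.toLp 2 fun i => F t (u i) s : EuclideanSpace ℝ ι) :=
    (WithLp.measurable_toLp 2 _).comp (measurable_pi_iff.2 fun i => hrun.measurable_F _ _)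
  -- Disintegrate over the objective and history; the sampling hypothesis identifies the conditional
  -- law with `postKernel`, which sees the history only.
  rw [← lintegral_map hΦ (hV.prodMk hF), ← compProd_map_condDistrib hF.aemeasurable,
    Measure.lintegral_compProd hΦ, lintegral_map (hΦ.lintegral_kernel_prod_right') hV]
  refine lintegral_congr_ae ?_
  filter_upwards [hrun.sample t ι u] with s hs
  rw [hs]
  rfl

lemma map_siteValues_zero (hk : (Matrix.of k).PosSemidef)
    (hrun : IsRun Pr w U k σ f ε F x P j y) :
    Pr.map (siteValues w f) = multivariateGaussian 0 (gram k (site w)) := by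
  have hg : HasGaussianLaw (fun s (a : 𝒳 × Fin n) => f (site w a) s) Pr := by
    let I : Finset (Dom 𝒳 Ω) := Finset.univ.image (site w)
    have h := hrun.prior.gaussian.hasGaussianLaw I
    exact h.map_fun (ContinuousLinearMap.pi fun a : 𝒳 × Fin n =>
      ContinuousLinearMap.proj (R := ℝ) (φ := fun _ : I => ℝ)
        ⟨site w a, Finset.mem_image_of_mem _ (Finset.mem_univ a)⟩)
  have hm := measurable_siteValues (w := w) hrun.measurable_f
  have : IsGaussian (Pr.map (siteValues w f)) := (hg.toLp_pi 2).isGaussian_map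
  refine eq_multivariateGaussian (gram_posSemidef hk _) (fun i => ?_) fun i l => ?_
  · rw [integral_map hm.aemeasurable (by fun_prop)]
    exact hrun.prior.mean _
  · rw [covariance_map_fun (by fun_prop) (by fun_prop) hm.aemeasurable]
    exact hrun.prior.cov _ _

/-- If the posterior of the objective given the history is the posterior Gaussian process, then it
is not changed by knowing the posterior sample. -/
lemma map_history_sample_siteValues (hrun : IsRun Pr w U k σ f ε F x P j y) (t : ℕ)
    (hA : Pr.map (fun s => (history x j y F t s, siteValues w f s)) =
      (Pr.map (history x j y F t)) ⊗ₘ postKernel w k σ (site w)) :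
    Pr.map (fun s => ((history x j y F t s, fun u => F t u s), siteValues w f s)) =
      (Pr.map fun s => (history x j y F t s, fun u => F t u s)) ⊗ₘ
        (postKernel w k σ (site w)).comap Prod.fst measurable_fst := by
  classical
  have hH := hrun.measurable_history t
  have hF := hrun.measurable_sample t
  have hf := measurable_siteValues (w := w) hrun.measurable_f
  set H := history x j y F t with hHdef
  set κ : Kernel (Hist 𝒳 Ω n t) (EuclideanSpace ℝ (𝒳 × Fin n)) := postKernel w k σ (site w) with hκ
  have hAl : ∀ {Φ : Hist 𝒳 Ω n t × EuclideanSpace ℝ (𝒳 × Fin n) → ℝ≥0∞}, Measurable Φ →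
      ∫⁻ s, Φ (H s, siteValues w f s) ∂Pr = ∫⁻ s, ∫⁻ v, Φ (H s, v) ∂(κ (H s)) ∂Pr := by
    intro Φ hΦ
    rw [← lintegral_map hΦ (hH.prodMk hf), hA, Measure.lintegral_compProd hΦ,
      lintegral_map hΦ.lintegral_kernel_prod_right' hH]
  -- Product sets suffice: `A` tests the history, `C` the sample function and `D` the site values of
  -- the objective.
  refine Measure.ext_prod₃' fun {A C D} hA' hC hD => ?_
  have hκD : Measurable fun s => κ (H s) D := (κ.measurable_coe hD).comp hH
  -- On the event that the history is in `A`, `μ₁` is the law of the sample restricted to `f` in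
  -- `D`, while `μ₂` replaces that restriction by the posterior probability of `D`. The sampling
  -- hypothesis concerns finite-dimensional marginals only, so the two are compared as projective
  -- limits.
  let μ₁ : Measure (Dom 𝒳 Ω → ℝ) := (Pr.restrict (H ⁻¹' A ∩ siteValues w f ⁻¹' D)).map
    fun s u => F t u s
  let μ₂ : Measure (Dom 𝒳 Ω → ℝ) := ((Pr.restrict (H ⁻¹' A)).withDensity
    fun s => κ (H s) D).map fun s u => F t u s
  have hμ : μ₁ = μ₂ := by
    refine IsProjectiveLimit.unique (P := fun I => μ₁.map I.restrict) (fun I => rfl) fun I => ?_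
    ext E hE
    have hE' : MeasurableSet {v : EuclideanSpace ℝ I | (fun i => v i) ∈ E} :=
      (WithLp.measurable_ofLp 2 _) hE
    have hmE : MeasurableSet (I.restrict (π := fun _ => ℝ) ⁻¹' E) :=
      (Finset.measurable_restrict I) hE
    rw [Measure.map_apply (Finset.measurable_restrict I) hE,
      Measure.map_apply (Finset.measurable_restrict I) hE,
      Measure.map_apply hF hmE, Measure.map_apply hF hmE, withDensity_apply _ (hF hmE),
      Measure.restrict_restrict (hF hmE), Measure.restrict_apply (hF hmE)]
    set κI : Kernel (Hist 𝒳 Ω n t) (EuclideanSpace ℝ I) :=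
      postKernel w k σ (fun i : I => (i : Dom 𝒳 Ω)) with hκI
    set E' : Set (EuclideanSpace ℝ I) := {v | (fun i => v i) ∈ E} with hE'def
    have hκIE : Measurable fun h => κI h E' := κI.measurable_coe hE'
    have hAi : Measurable (A.indicator (1 : Hist 𝒳 Ω n t → ℝ≥0∞)) :=
      measurable_one.indicator hA'
    have hDi : Measurable (D.indicator (1 : EuclideanSpace ℝ (𝒳 × Fin n) → ℝ≥0∞)) :=
      measurable_one.indicator hD
    have hEi : Measurable (E'.indicator (1 : EuclideanSpace ℝ I → ℝ≥0∞)) :=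
      measurable_one.indicator hE'
    have hsv : Measurable fun φ : Dom 𝒳 Ω → ℝ =>
        (WithLp.toLp 2 fun a => φ (site w a) : EuclideanSpace ℝ (𝒳 × Fin n)) := by fun_prop
    -- Three exchanges: `h1` replaces the event on the sample by its posterior probability `κI`;
    -- `h3` does the same for the event on `f`, producing `κ`; `h2`, read backwards, restores the
    -- event on the sample.
    have h1 := hrun.lintegral_sample t (fun i : I => (i : Dom 𝒳 Ω))
      (Φ := fun q => A.indicator 1 q.1.2 * D.indicator 1 (WithLp.toLp 2 fun a => q.1.1 (site w a)) *
        E'.indicator 1 q.2) (by fun_prop)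
    have h2 := hrun.lintegral_sample t (fun i : I => (i : Dom 𝒳 Ω))
      (Φ := fun q => A.indicator 1 q.1.2 * κ q.1.2 D * E'.indicator 1 q.2)
      (((hAi.comp (by fun_prop)).mul ((κ.measurable_coe hD).comp (by fun_prop))).mul
        (hEi.comp measurable_snd))
    have h3 := hAl (Φ := fun q => A.indicator 1 q.1 * κI q.1 E' * D.indicator 1 q.2)
      (((hAi.comp measurable_fst).mul (hκIE.comp measurable_fst)).mul (hDi.comp measurable_snd))
    have e1 : ∀ h : Hist 𝒳 Ω n t, ∀ c : ℝ≥0∞,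
        ∫⁻ v, c * E'.indicator 1 v ∂(κI h) = c * κI h E' := fun h c => by
      rw [lintegral_const_mul _ hEi, lintegral_indicator_one hE']
    have e2 : ∀ h : Hist 𝒳 Ω n t, ∀ c : ℝ≥0∞,
        ∫⁻ v, c * D.indicator 1 v ∂(κ h) = c * κ h D := fun h c => by
      rw [lintegral_const_mul _ hDi, lintegral_indicator_one hD]
    simp only [← hκI, e1] at h1 h2
    simp only [e2] at h3
    have e3 : ∀ s, A.indicator (1 : Hist 𝒳 Ω n t → ℝ≥0∞) (H s) *
        D.indicator 1 (WithLp.toLp 2 fun a => f (site w a) s) * κI (H s) E' =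
        A.indicator 1 (H s) * κI (H s) E' * D.indicator 1 (siteValues w f s) := fun s => by
      rw [mul_right_comm]; rfl
    have e4 : ∀ s, A.indicator (1 : Hist 𝒳 Ω n t → ℝ≥0∞) (H s) * κ (H s) D * κI (H s) E' =
        A.indicator 1 (H s) * κI (H s) E' * κ (H s) D := fun s => mul_right_comm _ _ _
    rw [lintegral_congr e3, h3] at h1
    rw [lintegral_congr e4, ← h1] at h2
    have hset : MeasurableSet ((fun s u => F t u s) ⁻¹' (I.restrict (π := fun _ => ℝ) ⁻¹' E)) :=
      hF hmE
    rw [← lintegral_indicator_one (hset.inter ((hH hA').inter (hf hD))),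
      ← lintegral_indicator (hset.inter (hH hA'))]
    let FI : S → EuclideanSpace ℝ I := fun s => WithLp.toLp 2 fun i : I => F t i s
    refine Eq.symm <| (lintegral_congr fun s =>
      indicator_preimage_inter₃ H (siteValues w f) FI A D E' s).trans
      (h2.symm.trans (lintegral_congr fun s => indicator_preimage_inter₂ H FI A E'
        (fun s => κ (H s) D) s).symm)
  have h := congrArg (fun μ => μ C) hμ
  rw [Measure.map_apply hF hC, Measure.map_apply hF hC, withDensity_apply _ (hF hC),
    Measure.restrict_restrict (hF hC), Measure.restrict_apply (hF hC)] at h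
  rw [Measure.map_apply ((hH.prodMk hF).prodMk hf) ((hA'.prod hC).prod hD),
    Measure.compProd_apply_prod (hA'.prod hC) hD]
  rw [setLIntegral_map (hA'.prod hC) (Kernel.measurable_coe _ hD) (hH.prodMk hF)]
  have s1 : (fun s => ((H s, fun u => F t u s), siteValues w f s)) ⁻¹' ((A ×ˢ C) ×ˢ D) =
      (fun s u => F t u s) ⁻¹' C ∩ (H ⁻¹' A ∩ siteValues w f ⁻¹' D) := by
    ext s
    exact ⟨fun h => ⟨h.1.2, h.1.1, h.2⟩, fun h => ⟨⟨h.2.1, h.1⟩, h.2.2⟩⟩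
  have s2 : (fun s => (H s, fun u => F t u s)) ⁻¹' (A ×ˢ C) =
      (fun s u => F t u s) ⁻¹' C ∩ H ⁻¹' A := by
    ext s
    exact ⟨fun h => ⟨h.2, h.1⟩, fun h => ⟨h.2, h.1⟩⟩
  rw [s1, s2, h]
  rfl

end IsRun

end Run

/-! ### Bayesian updating along the run -/

section Run

variable {d m n : ℕ} {𝒳 : Finset (EuclideanSpace ℝ (Fin d))} {Ω : Set (EuclideanSpace ℝ (Fin m))}
  {w : Fin n → Ω} {k : Dom 𝒳 Ω → Dom 𝒳 Ω → ℝ} {σ : ℝ} {U : Finset (Fin n → ℝ)}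
  {S : Type*} [MeasurableSpace S] {Pr : Measure S} [IsProbabilityMeasure Pr]
  {f : Dom 𝒳 Ω → S → ℝ} {ε : ℕ → S → ℝ} {F : ℕ → Dom 𝒳 Ω → S → ℝ}
  {x : ℕ → S → 𝒳} {P : ℕ → S → 𝒳 → Fin n → ℝ} {j : ℕ → S → Fin n} {y : ℕ → S → ℝ}

/-- One more round of a history. -/
def Hist.append {t : ℕ} (p : Hist 𝒳 Ω n t × (Dom 𝒳 Ω → ℝ)) (a : 𝒳 × Fin n) (r : ℝ) :
    Hist 𝒳 Ω n (t + 1) :=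
  Fin.snoc (α := fun _ => 𝒳 × Fin n × ℝ × (Dom 𝒳 Ω → ℝ)) p.1 (a.1, a.2, r, p.2)

lemma Hist.measurable_append {t : ℕ} : Measurable
    fun q : (Hist 𝒳 Ω n t × (Dom 𝒳 Ω → ℝ)) × (𝒳 × Fin n) × ℝ =>
      Hist.append q.1 q.2.1 q.2.2 := by
  refine measurable_pi_iff.2 fun i => Fin.lastCases ?_ (fun i => ?_) i
  · simp only [Hist.append, Fin.snoc_last]
    fun_prop
  · simp only [Hist.append, Fin.snoc_castSucc]
    fun_prop

omit [MeasurableSpace S] in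
lemma history_succ (t : ℕ) (s : S) : history x j y F (t + 1) s =
    Hist.append (history x j y F t s, fun u => F t u s) (x t s, j t s) (y t s) := by
  ext1 i
  refine Fin.lastCases ?_ (fun i => ?_) i
  · simp [Hist.append, history]
  · simp [Hist.append, history]

/-- The posterior after one more observation. -/
lemma postKernel_append (hk : (Matrix.of k).PosSemidef) (hσ : 0 < σ) {t : ℕ}
    (p : Hist 𝒳 Ω n t × (Dom 𝒳 Ω → ℝ)) (a : 𝒳 × Fin n) (r : ℝ) :
    postKernel w k σ (site w) (Hist.append p a r) =
      multivariateGaussian (postMeanVec w k σ (site w) p.1 + WithLp.toLp 2 fun i =>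
        (r - postMeanVec w k σ (site w) p.1 a) /
          (gram (postCov k σ (histQueries w p.1)) (site w) a a + (σ ^ 2).toNNReal) *
          gram (postCov k σ (histQueries w p.1)) (site w) i a)
      (gram (postCov k σ (histQueries w (Hist.append p a r))) (site w)) := by
  rw [postKernel_apply]
  congr 1
  ext i
  have h := postMean_succ hk hσ (histQueries w (Hist.append p a r)) (histObs (Hist.append p a r))
    (site w i)
  simp only [histQueries, histObs, Hist.append, Fin.snoc_castSucc, Fin.snoc_last] at h
  simp only [postMeanVec, PiLp.add_apply, gram, Matrix.of_apply, Real.coe_toNNReal _ (sq_nonneg σ)]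
  exact h

/-- This is the covariance update demanded by `lintegral_noisy_observation`. The right side does not
involve `r`: the observed value has no effect on the posterior covariance. -/
lemma gram_postCov_append (hk : (Matrix.of k).PosSemidef) (hσ : 0 < σ) {t : ℕ}
    (p : Hist 𝒳 Ω n t × (Dom 𝒳 Ω → ℝ)) (a : 𝒳 × Fin n) (r : ℝ) (i l : 𝒳 × Fin n) :
    gram (postCov k σ (histQueries w (Hist.append p a r))) (site w) i l =
      gram (postCov k σ (histQueries w p.1)) (site w) i l -
      gram (postCov k σ (histQueries w p.1)) (site w) i a *
      gram (postCov k σ (histQueries w p.1)) (site w) l a /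
      (gram (postCov k σ (histQueries w p.1)) (site w) a a + (σ ^ 2).toNNReal) := by
  have h := postCov_succ hk hσ (histQueries w (Hist.append p a r)) (site w i) (site w l)
  simp only [histQueries, Hist.append, Fin.snoc_castSucc, Fin.snoc_last] at h
  simp only [gram, Matrix.of_apply, Real.coe_toNNReal _ (sq_nonneg σ)]
  exact h

namespace IsRun

/-- The query of a round as a function of the past and the posterior sample. -/
lemma exists_query_eq (hrun : IsRun Pr w U k σ f ε F x P j y) (t : ℕ) :
    ∃ q : Hist 𝒳 Ω n t × (Dom 𝒳 Ω → ℝ) → 𝒳 × Fin n, Measurable q ∧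
      ∀ s, (x t s, j t s) = q (history x j y F t s, fun u => F t u s) := by
  obtain ⟨s⟩ : Nonempty S := Pr.nonempty_of_neZero
  have : Nonempty 𝒳 := ⟨x t s⟩
  have : Nonempty (Fin n) := ⟨j t s⟩
  have h := ((hrun.measurable_x t).prodMk (hrun.measurable_j t)).exists_eq_measurable_comp
  obtain ⟨q, hq, hqe⟩ := h
  exact ⟨q, hq, fun s => congrFun hqe s⟩

/-- **Bayesian updating.** Given the history, the objective is distributed according to the
posterior Gaussian process. -/
lemma map_history_siteValues (hk : (Matrix.of k).PosSemidef) (hσ : 0 < σ)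
    (hrun : IsRun Pr w U k σ f ε F x P j y) (t : ℕ) :
    Pr.map (fun s => (history x j y F t s, siteValues w f s)) =
      (Pr.map (history x j y F t)) ⊗ₘ postKernel w k σ (site w) := by
  classical
  have hf := measurable_siteValues (w := w) hrun.measurable_f
  induction t with
  | zero =>
    have hH := hrun.measurable_history 0
    refine Measure.ext_of_lintegral _ fun Φ hΦ => ?_
    rw [lintegral_map hΦ (hH.prodMk hf), Measure.lintegral_compProd hΦ,
      lintegral_map hΦ.lintegral_kernel_prod_right' hH]
    have h0 : ∀ s, history x j y F 0 s = default := fun s => Subsingleton.elim _ _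
    have hκ : postKernel w k σ (site w) (default : Hist 𝒳 Ω n 0) =
        multivariateGaussian 0 (gram k (site w)) := by
      rw [postKernel_apply]
      have h1 : postMeanVec w k σ (site w) (default : Hist 𝒳 Ω n 0) = 0 := by
        ext i; simp [postMeanVec, postMean]
      have h2 : gram (postCov k σ (histQueries w (default : Hist 𝒳 Ω n 0))) (site w) =
          gram k (site w) := by
        ext i l; simp [gram, postCov]
      rw [h1, h2]
    simp only [h0, hκ, lintegral_const, measure_univ, mul_one]
    rw [← hrun.map_siteValues_zero hk, lintegral_map (by fun_prop) hf]
  | succ t ih =>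
    -- The query may depend on the posterior sample, so the sample must join the conditioning before
    -- the new observation is treated.
    have hB := hrun.map_history_sample_siteValues t ih
    have hHF := hrun.measurable_history_sample t
    have hH' := hrun.measurable_history (t + 1)
    obtain ⟨q, hq, hqe⟩ := hrun.exists_query_eq t
    set HF : S → Hist 𝒳 Ω n t × (Dom 𝒳 Ω → ℝ) :=
      fun s => (history x j y F t s, fun u => F t u s) with hHFdef
    set N := gaussianReal 0 (σ ^ 2).toNNReal with hN
    set κ : Kernel (Hist 𝒳 Ω n t × (Dom 𝒳 Ω → ℝ)) (EuclideanSpace ℝ (𝒳 × Fin n)) :=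
      (postKernel w k σ (site w)).comap Prod.fst measurable_fst with hκ
    have hmz : Measurable fun p : (𝒳 × Fin n) × EuclideanSpace ℝ (𝒳 × Fin n) => p.2 p.1 :=
      measurable_from_prod_countable_right fun c =>
        (EuclideanSpace.proj (𝕜 := ℝ) c).continuous.measurable
    have hHs : ∀ s, history x j y F (t + 1) s =
        Hist.append (HF s) (q (HF s)) (siteValues w f s (q (HF s)) + ε t s) := fun s => by
      rw [history_succ, hrun.obs]
      simp only [hHFdef, ← hqe]
      rfl
    have hind : Pr.map (fun s => ((HF s, siteValues w f s), ε t s)) =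
        (Pr.map fun s => (HF s, siteValues w f s)).prod N := by
      have h1 : IndepFun (ε t) (fun s => (HF s, siteValues w f s)) Pr :=
        (hrun.noise_indep t).comp (φ := id)
          (ψ := fun r : (Dom 𝒳 Ω → ℝ) × Hist 𝒳 Ω n t × (Dom 𝒳 Ω → ℝ) =>
            (r.2, (WithLp.toLp 2 fun a => r.1 (site w a) : EuclideanSpace ℝ (𝒳 × Fin n))))
          measurable_id (by fun_prop)
      rw [(indepFun_iff_map_prod_eq_prod_map_map (hHF.prodMk hf).aemeasurable
        (hrun.measurable_ε t).aemeasurable).1 h1.symm, (hrun.noise t).map_eq]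
    -- Integrals over the new history and `f` are expressed by the old posterior and fresh noise:
    -- the query is frozen given `HF`, and the observation is one coordinate of a Gaussian vector
    -- plus noise.
    have key : ∀ Φ : Hist 𝒳 Ω n (t + 1) × EuclideanSpace ℝ (𝒳 × Fin n) → ℝ≥0∞, Measurable Φ →
        ∫⁻ s, Φ (history x j y F (t + 1) s, siteValues w f s) ∂Pr =
        ∫⁻ s, ∫⁻ p, Φ (Hist.append (HF s) (q (HF s)) (p.1 (q (HF s)) + p.2), p.1)
          ∂((κ (HF s)).prod N) ∂Pr := by
      intro Φ hΦ
      have hG : Measurable fun r : ((Hist 𝒳 Ω n t × (Dom 𝒳 Ω → ℝ)) ×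
          EuclideanSpace ℝ (𝒳 × Fin n)) × ℝ =>
          Φ (Hist.append r.1.1 (q r.1.1) (r.1.2 (q r.1.1) + r.2), r.1.2) := by
        refine hΦ.comp (Measurable.prodMk ?_ (by fun_prop))
        refine Hist.measurable_append.comp (measurable_fst.fst.prodMk
          ((hq.comp measurable_fst.fst).prodMk (Measurable.add ?_ measurable_snd)))
        exact hmz.comp ((hq.comp measurable_fst.fst).prodMk measurable_fst.snd)
      simp only [hHs]
      rw [← lintegral_map hG ((hHF.prodMk hf).prodMk (hrun.measurable_ε t)), hind,
        lintegral_prod _ hG.aemeasurable, hB,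
        Measure.lintegral_compProd hG.lintegral_prod_right',
        lintegral_map hG.lintegral_prod_right'.lintegral_kernel_prod_right' hHF]
      refine lintegral_congr fun s => ?_
      rw [lintegral_prod]
      exact (hG.comp (f := fun p : EuclideanSpace ℝ (𝒳 × Fin n) × ℝ => ((HF s, p.1), p.2))
        (by fun_prop)).aemeasurable
    refine Measure.ext_of_lintegral _ fun Φ hΦ => ?_
    -- `key` is used on both sides: for `Φ`, and for `Φ` with the objective integrated out under the
    -- new posterior, which is a function of the new history alone.
    rw [lintegral_map hΦ (hH'.prodMk hf), Measure.lintegral_compProd hΦ,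
      lintegral_map hΦ.lintegral_kernel_prod_right' hH', key Φ hΦ,
      key (fun r => ∫⁻ v, Φ (r.1, v) ∂(postKernel w k σ (site w) r.1))
        (hΦ.lintegral_kernel_prod_right'.comp measurable_fst)]
    refine lintegral_congr fun s => ?_
    have hΦ' : Measurable fun r : ℝ × EuclideanSpace ℝ (𝒳 × Fin n) =>
        Φ (Hist.append (HF s) (q (HF s)) r.1, r.2) :=
      hΦ.comp ((Hist.measurable_append.comp (measurable_const.prodMk
        (measurable_const.prodMk measurable_fst))).prodMk measurable_snd)
    have h := lintegral_noisy_observation (m := postMeanVec w k σ (site w) (HF s).1)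
      (gram_postCov_posSemidef hk hσ (histQueries w (HF s).1) (site w))
      (gram_postCov_posSemidef hk hσ (histQueries w (Hist.append (HF s) (q (HF s)) 0)) (site w))
      (q (HF s)) (τ := (σ ^ 2).toNNReal) (by simpa using hσ.ne')
      (gram_postCov_append hk hσ (HF s) (q (HF s)) 0) hΦ'
    refine h.trans (lintegral_congr fun p => ?_)
    simp only [postKernel_append hk hσ]
    have e : ∀ r, histQueries w (Hist.append (HF s) (q (HF s)) r) =
        histQueries w (Hist.append (HF s) (q (HF s)) 0) := fun r => by
      ext1 i
      refine Fin.lastCases ?_ (fun i => ?_) i <;> simp [histQueries, Hist.append]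
    rw [e (_ + _)]

/-- The objective and the posterior sample have the same conditional law given the history. -/
lemma map_history_siteValues_sample (hrun : IsRun Pr w U k σ f ε F x P j y) (t : ℕ) :
    Pr.map (fun s => (history x j y F t s, siteValues w (F t) s)) =
      (Pr.map (history x j y F t)) ⊗ₘ postKernel w k σ (site w) := by
  classical
  have hH := hrun.measurable_history t
  refine Measure.ext_of_lintegral _ fun Φ hΦ => ?_
  rw [lintegral_map hΦ (hH.prodMk (measurable_siteValues (hrun.measurable_F t))),
    Measure.lintegral_compProd hΦ, lintegral_map hΦ.lintegral_kernel_prod_right' hH]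
  exact hrun.lintegral_sample t (site w) (Φ := fun r => Φ (r.1.2, r.2)) (by fun_prop)

end IsRun

end Run

/-- The variance of the difference of two coordinates is nonnegative. -/
lemma posSemidef_apply_le {ι : Type*} [Fintype ι] [DecidableEq ι] {C : Matrix ι ι ℝ}
    (hC : C.PosSemidef) (a b : ι) : 2 * C a b ≤ C a a + C b b := by
  have h := hC.dotProduct_mulVec_nonneg (Pi.single a 1 - Pi.single b 1)
  have hs : C b a = C a b := by simpa using hC.isHermitian.apply a b
  simp [Matrix.mulVec_sub, sub_dotProduct, dotProduct_sub, hs] at h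
  linarith

/-- The variance of an average is at most the largest variance. -/
lemma dotProduct_mulVec_le {ι : Type*} [Fintype ι] [DecidableEq ι] {C : Matrix ι ι ℝ}
    (hC : C.PosSemidef) {p : ι → ℝ} (hp : ∀ a, 0 ≤ p a) (hp1 : ∑ a, p a = 1) {M : ℝ}
    (hM : ∀ a, p a ≠ 0 → C a a ≤ M) : p ⬝ᵥ (C *ᵥ p) ≤ M := by
  have h : ∀ a b, p a * (C a b * p b) ≤ p a * (M * p b) := fun a b => by
    by_cases ha : p a = 0
    · simp [ha]
    by_cases hb : p b = 0
    · simp [hb]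
    have := posSemidef_apply_le hC a b
    have := hM a ha
    have := hM b hb
    exact mul_le_mul_of_nonneg_left (mul_le_mul_of_nonneg_right (by linarith) (hp b)) (hp a)
  calc p ⬝ᵥ (C *ᵥ p) = ∑ a, ∑ b, p a * (C a b * p b) := by
        simp [dotProduct, Matrix.mulVec, Finset.mul_sum]
    _ ≤ ∑ a, ∑ b, p a * (M * p b) :=
        Finset.sum_le_sum fun a _ => Finset.sum_le_sum fun b _ => h a b
    _ = M := by simp [← Finset.mul_sum, ← Finset.sum_mul, hp1]

/-! ### The robust problem as a function of the site values -/

section Objective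

variable {d m n : ℕ} {𝒳 : Finset (EuclideanSpace ℝ (Fin d))} {Ω : Set (EuclideanSpace ℝ (Fin m))}
  {w : Fin n → Ω} {U : Finset (Fin n → ℝ)} {ρ : ℝ}

/-- The weights on the sites of the distribution `p` at the decision `x`. -/
noncomputable def siteWeight (x : 𝒳) (p : Fin n → ℝ) (a : 𝒳 × Fin n) : ℝ :=
  open Classical in if a.1 = x then p a.2 else 0

lemma sum_siteWeight_mul (x : 𝒳) (p : Fin n → ℝ) (v : 𝒳 × Fin n → ℝ) :
    ∑ a, siteWeight x p a * v a = ∑ i, p i * v (x, i) := by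
  classical
  simp only [siteWeight, ite_mul, zero_mul, Fintype.sum_prod_type]
  rw [Finset.sum_eq_single x]
  · simp
  · intro b _ hb; simp [hb]
  · simp

lemma expect_eq_sum_siteWeight {S : Type*} (f : Dom 𝒳 Ω → S → ℝ) (s : S) (x : 𝒳)
    (p : Fin n → ℝ) : expect w (fun u => f u s) x p = ∑ a, siteWeight x p a * siteValues w f s a :=
  (sum_siteWeight_mul x p fun a => siteValues w f s a).symm

lemma siteWeight_nonneg {p : Fin n → ℝ} (hp : ∀ i, 0 ≤ p i) (x : 𝒳) (a : 𝒳 × Fin n) :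
    0 ≤ siteWeight x p a := by
  unfold siteWeight; split_ifs <;> simp [hp]

lemma sum_siteWeight {p : Fin n → ℝ} (hp : ∑ i, p i = 1) (x : 𝒳) :
    ∑ a, siteWeight x p a = 1 := by
  simpa [hp] using sum_siteWeight_mul x p fun _ => 1

lemma siteWeight_le_one {p : Fin n → ℝ} (hp : ∀ i, 0 ≤ p i) (hp1 : ∑ i, p i = 1) (x : 𝒳)
    (a : 𝒳 × Fin n) : siteWeight x p a ≤ 1 :=
  (Finset.single_le_sum (fun b _ => siteWeight_nonneg hp x b) (Finset.mem_univ a)).trans_eq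
    (sum_siteWeight hp1 x)

lemma abs_sum_siteWeight_mul_le {p : Fin n → ℝ} (hp : ∀ i, 0 ≤ p i) (hp1 : ∑ i, p i = 1) (x : 𝒳)
    (v : 𝒳 × Fin n → ℝ) : |∑ a, siteWeight x p a * v a| ≤ ∑ a, |v a| := by
  refine (Finset.abs_sum_le_sum_abs _ _).trans (Finset.sum_le_sum fun a _ => ?_)
  rw [abs_mul, abs_of_nonneg (siteWeight_nonneg hp x a)]
  exact mul_le_of_le_one_left (abs_nonneg _) (siteWeight_le_one hp hp1 x a)

/-- The value of the distributionally robust optimization problem, as a function of the values of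
the objective at the sites. -/
noncomputable def optValue (U : Finset (Fin n → ℝ)) (v : EuclideanSpace ℝ (𝒳 × Fin n)) : ℝ :=
  ⨆ x : 𝒳, ⨅ p : U, ∑ a, siteWeight x p a * v a

lemma measurable_optValue : Measurable (optValue U : EuclideanSpace ℝ (𝒳 × Fin n) → ℝ) := by
  unfold optValue
  refine Measurable.iSup fun x => Measurable.iInf fun p => ?_
  fun_prop

/-- The optimal value does not depend on how ties are broken. It is thus a fixed measurable function
of the site values, which lets equality in law pass from `f` and `F t` to their optimal values. -/
lemma IsRobustOptimal.quadrature_eq {S : Type*} {f : Dom 𝒳 Ω → S → ℝ} {s : S} {x : 𝒳}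
    {P : 𝒳 → Fin n → ℝ} (h : IsRobustOptimal w U (fun u => f u s) x P) :
    quadrature w (fun u => f u s) x P = optValue U (siteValues w f s) := by
  have : Nonempty 𝒳 := ⟨x⟩
  have : Nonempty U := ⟨⟨P x, h.mem x⟩⟩
  have h1 : quadrature w (fun u => f u s) x P = robustValue w U (fun u => f u s) x :=
    le_antisymm (le_ciInf fun p => h.argmin x p p.2)
      (ciInf_le (f := fun p : U => expect w (fun u => f u s) x p) (Set.finite_range _).bddBelow
        ⟨P x, h.mem x⟩)
  have h2 : optValue U (siteValues w f s) = ⨆ x', robustValue w U (fun u => f u s) x' := by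
    simp only [optValue, robustValue, ← expect_eq_sum_siteWeight]
  rw [h1, h2]
  exact le_antisymm (le_ciSup (Set.finite_range _).bddAbove x) (ciSup_le h.argmax)

end Objective

/-! ### Expected regret of one round -/

section Run

variable {d m n : ℕ} {𝒳 : Finset (EuclideanSpace ℝ (Fin d))} {Ω : Set (EuclideanSpace ℝ (Fin m))}
  {w : Fin n → Ω} {k : Dom 𝒳 Ω → Dom 𝒳 Ω → ℝ} {σ : ℝ} {U : Finset (Fin n → ℝ)} {ρ : ℝ}
  {S : Type*} [MeasurableSpace S] {Pr : Measure S} [IsProbabilityMeasure Pr]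
  {f : Dom 𝒳 Ω → S → ℝ} {ε : ℕ → S → ℝ} {F : ℕ → Dom 𝒳 Ω → S → ℝ}
  {x : ℕ → S → 𝒳} {P : ℕ → S → 𝒳 → Fin n → ℝ} {j : ℕ → S → Fin n} {y : ℕ → S → ℝ}
  {xs : S → 𝒳} {Ps : S → 𝒳 → Fin n → ℝ}

/-- The posterior standard deviation at the location queried in round `t`. -/
noncomputable def queryStd (w : Fin n → Ω) (k : Dom 𝒳 Ω → Dom 𝒳 Ω → ℝ) (σ : ℝ)
    (x : ℕ → S → 𝒳) (j : ℕ → S → Fin n) (t : ℕ) (s : S) : ℝ :=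
  √(postCov k σ (queries w x j t s) (x t s, w (j t s)) (x t s, w (j t s)))

lemma measurable_postCov {t : ℕ} (u v : Dom 𝒳 Ω) : Measurable fun h : Hist 𝒳 Ω n t =>
    postCov k σ (histQueries w h) u v := by
  have h1 : Measurable fun q : Fin t → 𝒳 × Fin n =>
      postCov k σ (fun l => ((q l).1, w (q l).2)) u v := measurable_of_countable _
  have h2 : Measurable fun (h : Hist 𝒳 Ω n t) l => ((h l).1, (h l).2.1) := by fun_prop
  exact h1.comp h2

namespace IsRun

lemma integrable_siteValues (hrun : IsRun Pr w U k σ f ε F x P j y) (a : 𝒳 × Fin n) :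
    Integrable (fun s => siteValues w f s a) Pr :=
  (hrun.prior.gaussian.hasGaussianLaw_eval (site w a)).integrable

/-- The objective and the posterior sample have the same law. -/
lemma map_siteValues_eq (hk : (Matrix.of k).PosSemidef) (hσ : 0 < σ)
    (hrun : IsRun Pr w U k σ f ε F x P j y) (t : ℕ) :
    Pr.map (siteValues w f) = Pr.map (siteValues w (F t)) := by
  classical
  have h := (hrun.map_history_siteValues hk hσ t).trans (hrun.map_history_siteValues_sample t).symm
  have h2 := congrArg (Measure.map Prod.snd) h
  rwa [Measure.map_map measurable_snd ((hrun.measurable_history t).prodMk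
      (measurable_siteValues hrun.measurable_f)),
    Measure.map_map measurable_snd ((hrun.measurable_history t).prodMk
      (measurable_siteValues (hrun.measurable_F t)))] at h2

/-- Integrability is inherited from the objective through equality in law. -/
lemma integrable_siteValues_sample (hk : (Matrix.of k).PosSemidef) (hσ : 0 < σ)
    (hrun : IsRun Pr w U k σ f ε F x P j y) (t : ℕ) (a : 𝒳 × Fin n) :
    Integrable (fun s => siteValues w (F t) s a) Pr := by
  have h := hrun.integrable_siteValues (w := w) a
  have h1 : Integrable (fun v : EuclideanSpace ℝ (𝒳 × Fin n) => v a) (Pr.map (siteValues w f)) :=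
    (integrable_map_measure (by fun_prop)
      (measurable_siteValues hrun.measurable_f).aemeasurable).2 h
  rw [hrun.map_siteValues_eq hk hσ t] at h1
  exact (integrable_map_measure (by fun_prop)
    (measurable_siteValues (hrun.measurable_F t)).aemeasurable).1 h1

/-- The weights chosen by the algorithm are functions of the past and the sample, hence constants
when the objective is averaged given these data. -/
lemma measurable_siteWeight (hrun : IsRun Pr w U k σ f ε F x P j y) (t : ℕ) (a : 𝒳 × Fin n) :
    ∃ c : Hist 𝒳 Ω n t × (Dom 𝒳 Ω → ℝ) → ℝ, Measurable c ∧
      ∀ s, siteWeight (x t s) (P t s (x t s)) a = c (history x j y F t s, fun u => F t u s) := by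
  obtain ⟨s⟩ : Nonempty S := Pr.nonempty_of_neZero
  have : Nonempty 𝒳 := ⟨x t s⟩
  obtain ⟨q, hq, hqe⟩ := ((hrun.measurable_x t).prodMk
    (hrun.measurable_P t)).exists_eq_measurable_comp
  refine ⟨fun r => siteWeight (q r).1 ((q r).2 (q r).1) a, ?_, fun s => ?_⟩
  · have h : Measurable fun r : 𝒳 × (𝒳 → Fin n → ℝ) => siteWeight r.1 (r.2 r.1) a :=
      measurable_from_prod_countable_right fun c => by
        by_cases hc : a.1 = c
        · simp only [siteWeight, hc, if_true]; fun_prop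
        · simp only [siteWeight, hc, if_false]; fun_prop
    exact h.comp hq
  · have := congrFun hqe s
    simp only [Function.comp] at this
    simp only [← this]

/-- Given the past and the posterior sample, the mean of the objective is the posterior mean. -/
lemma integral_mul_siteValues (hk : (Matrix.of k).PosSemidef) (hσ : 0 < σ)
    (hrun : IsRun Pr w U k σ f ε F x P j y) (t : ℕ) (a : 𝒳 × Fin n)
    {c : Hist 𝒳 Ω n t × (Dom 𝒳 Ω → ℝ) → ℝ} (hc : Measurable c) {M : ℝ}
    (hM : ∀ s, |c (history x j y F t s, fun u => F t u s)| ≤ M) :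
    Integrable (fun s => c (history x j y F t s, fun u => F t u s) *
      postMeanVec w k σ (site w) (history x j y F t s) a) Pr ∧
    ∫ s, c (history x j y F t s, fun u => F t u s) * siteValues w f s a ∂Pr =
      ∫ s, c (history x j y F t s, fun u => F t u s) *
        postMeanVec w k σ (site w) (history x j y F t s) a ∂Pr := by
  classical
  have hf := measurable_siteValues (w := w) hrun.measurable_f
  have hHF := hrun.measurable_history_sample t
  have hB := hrun.map_history_sample_siteValues t (hrun.map_history_siteValues hk hσ t)
  set HF : S → Hist 𝒳 Ω n t × (Dom 𝒳 Ω → ℝ) :=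
    fun s => (history x j y F t s, fun u => F t u s) with hHFdef
  have hint : Integrable (fun s => c (HF s) * siteValues w f s a) Pr :=
    (hrun.integrable_siteValues a).bdd_mul (c := M) (hc.comp hHF).aestronglyMeasurable
      (Eventually.of_forall hM)
  have hm : Measurable fun r : (Hist 𝒳 Ω n t × (Dom 𝒳 Ω → ℝ)) × EuclideanSpace ℝ (𝒳 × Fin n) =>
      c r.1 * r.2 a := by fun_prop
  have hint' := (integrable_map_measure hm.aestronglyMeasurable
    (hHF.prodMk hf).aemeasurable).2 hint
  rw [hB] at hint'
  have h1 := integral_map (hHF.prodMk hf).aemeasurable hm.aestronglyMeasurable (μ := Pr)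
  rw [hB, Measure.integral_compProd hint'] at h1
  have e : ∀ r : Hist 𝒳 Ω n t × (Dom 𝒳 Ω → ℝ), ∫ v : EuclideanSpace ℝ (𝒳 × Fin n), c r * v a
      ∂(postKernel w k σ (site w) r.1) =
      c r * postMeanVec w k σ (site w) r.1 a := fun r => by
    rw [integral_const_mul]
    congr 1
    exact integral_eval_multivariateGaussian _ _ a
  simp only [Kernel.comap_apply, e] at h1
  have hm2 : Measurable fun r : Hist 𝒳 Ω n t × (Dom 𝒳 Ω → ℝ) =>
      c r * postMeanVec w k σ (site w) r.1 a := by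
    exact hc.mul (((EuclideanSpace.proj (𝕜 := ℝ) a).continuous.measurable.comp
      (measurable_postMeanVec w k σ (t := t) (site w))).comp measurable_fst)
  -- The posterior mean is dominated by the conditional integral of the norm, which is integrable by
  -- Fubini for `⊗ₘ`.
  have h2 : Integrable (fun r : Hist 𝒳 Ω n t × (Dom 𝒳 Ω → ℝ) =>
      c r * postMeanVec w k σ (site w) r.1 a) (Pr.map HF) := by
    refine ((Measure.integrable_compProd_iff hint'.1).1 hint').2.mono hm2.aestronglyMeasurable
      (Eventually.of_forall fun r => ?_)
    rw [← e]
    exact (norm_integral_le_integral_norm _).trans (le_abs_self _)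
  rw [integral_map hHF.aemeasurable hm2.aestronglyMeasurable] at h1
  exact ⟨(integrable_map_measure hm2.aestronglyMeasurable hHF.aemeasurable).1 h2, h1.symm⟩

lemma integrable_postMeanVec (hk : (Matrix.of k).PosSemidef) (hσ : 0 < σ)
    (hrun : IsRun Pr w U k σ f ε F x P j y) (t : ℕ) (a : 𝒳 × Fin n) :
    Integrable (fun s => postMeanVec w k σ (site w) (history x j y F t s) a) Pr := by
  simpa using (hrun.integral_mul_siteValues hk hσ t a (c := fun _ => 1) measurable_const (M := 1)
    (by simp)).1

/-- The posterior sample rarely exceeds the posterior mean by many standard deviations. -/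
lemma integral_posPart_le (hk : (Matrix.of k).PosSemidef) (hk1 : ∀ u v, k u v ≤ 1) (hσ : 0 < σ)
    (hrun : IsRun Pr w U k σ f ε F x P j y) (t : ℕ) (x' : 𝒳) {p : Fin n → ℝ}
    (hp : ∀ i, 0 ≤ p i) (hp1 : ∑ i, p i = 1) {b : ℝ} (hb : 0 ≤ b) :
    Integrable (fun s => max (∑ a, siteWeight x' p a * (siteValues w (F t) s a -
      postMeanVec w k σ (site w) (history x j y F t s) a) -
      b * √(siteWeight x' p ⬝ᵥ (gram (postCov k σ (queries w x j t s)) (site w) *ᵥ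
        siteWeight x' p))) 0) Pr ∧
    ∫ s, max (∑ a, siteWeight x' p a * (siteValues w (F t) s a -
      postMeanVec w k σ (site w) (history x j y F t s) a) -
      b * √(siteWeight x' p ⬝ᵥ (gram (postCov k σ (queries w x j t s)) (site w) *ᵥ
        siteWeight x' p))) 0 ∂Pr ≤ Real.exp (-b ^ 2 / 2) / √(2 * Real.pi) := by
  classical
  have hH := hrun.measurable_history t
  have hF := measurable_siteValues (w := w) (hrun.measurable_F t)
  set c := siteWeight x' p with hc
  let v : Hist 𝒳 Ω n t → ℝ := fun h =>
    c ⬝ᵥ (gram (postCov k σ (histQueries w h)) (site w) *ᵥ c)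
  have hC : ∀ h : Hist 𝒳 Ω n t, (gram (postCov k σ (histQueries w h)) (site w)).PosSemidef :=
    fun h => gram_postCov_posSemidef hk hσ _ _
  have hv0 : ∀ h, 0 ≤ v h := fun h => by
    simpa using (hC h).dotProduct_mulVec_nonneg c
  -- Conditioning only decreases variances, averaging does not exceed the largest one, and `k ≤ 1`.
  have hv1 : ∀ h, v h ≤ 1 := fun h =>
    dotProduct_mulVec_le (hC h) (siteWeight_nonneg hp x') (sum_siteWeight hp1 x') fun a _ =>
      (postCov_self_le_kernel hk hσ _ _).trans (hk1 _ _)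
  have hvm : Measurable v := by
    have := fun a a' : 𝒳 × Fin n =>
      measurable_postCov (w := w) (k := k) (σ := σ) (t := t) (site w a) (site w a')
    simp only [v, dotProduct, Matrix.mulVec, gram, Matrix.of_apply]
    fun_prop
  have hmm := measurable_postMeanVec w k σ (t := t) (site w)
  let Φ : Hist 𝒳 Ω n t × EuclideanSpace ℝ (𝒳 × Fin n) → ℝ := fun r =>
    max (∑ a, c a * (r.2 a - postMeanVec w k σ (site w) r.1 a) - b * √(v r.1)) 0
  have hΦ : Measurable Φ := by
    refine Measurable.max (Measurable.sub ?_ ?_) measurable_const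
    · exact Finset.measurable_sum _ fun a _ => (Measurable.sub (by fun_prop)
        (((EuclideanSpace.proj (𝕜 := ℝ) a).continuous.measurable.comp hmm).comp
          measurable_fst)).const_mul _
    · exact ((hvm.comp measurable_fst).sqrt).const_mul b
  have hint : Integrable (fun s => Φ (history x j y F t s, siteValues w (F t) s)) Pr := by
    refine Integrable.pos_part (Integrable.sub (integrable_finsetSum _ fun a _ =>
      ((hrun.integrable_siteValues_sample hk hσ t a).sub
        (hrun.integrable_postMeanVec hk hσ t a)).const_mul _) (Integrable.const_mul ?_ _))
    refine Integrable.of_bound (C := 1) (hvm.comp hH).sqrt.aestronglyMeasurable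
      (Eventually.of_forall fun s => ?_)
    rw [Real.norm_of_nonneg (Real.sqrt_nonneg _)]
    exact Real.sqrt_le_one.2 (hv1 _)
  refine ⟨hint, ?_⟩
  have hlaw := hrun.map_history_siteValues_sample t
  have hint' := (integrable_map_measure hΦ.aestronglyMeasurable (hH.prodMk hF).aemeasurable).2 hint
  rw [hlaw] at hint'
  have h1 := integral_map (hH.prodMk hF).aemeasurable hΦ.aestronglyMeasurable (μ := Pr)
  rw [hlaw, Measure.integral_compProd hint'] at h1
  refine h1.symm.trans_le ?_
  have hbound : ∀ h, ∫ u, Φ (h, u) ∂(postKernel w k σ (site w) h) ≤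
      Real.exp (-b ^ 2 / 2) / √(2 * Real.pi) := by
    intro h
    -- Centring at the posterior mean leaves a one-dimensional centred Gaussian of variance `v h`,
    -- to which the truncated-mean estimate applies.
    have e : postMeanVec w k σ (site w) h = 0 + postMeanVec w k σ (site w) h := (zero_add _).symm
    rw [postKernel_apply, e, multivariateGaussian_add,
      integral_map (f := fun u => Φ (h, u)) (by fun_prop)
        (hΦ.comp measurable_prodMk_left).aestronglyMeasurable]
    simp only [Φ, PiLp.add_apply, add_sub_cancel_right]
    have h2 := integral_map (μ := multivariateGaussian 0
      (gram (postCov k σ (histQueries w h)) (site w)))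
      (φ := fun u : EuclideanSpace ℝ (𝒳 × Fin n) => ∑ a, c a * u a) (by fun_prop)
      (f := fun r => max (r - b * √(v h)) 0) (by fun_prop)
    rw [← h2, map_dotProduct_multivariateGaussian (hC h)]
    have h3 := integral_posPart_sub_mul_gaussianReal_le hb (Real.sqrt_nonneg (v h))
    rw [Real.sq_sqrt (hv0 h)] at h3
    refine h3.trans (mul_le_of_le_one_left (by positivity) (Real.sqrt_le_one.2 (hv1 h)))
  calc _ ≤ ∫ _, Real.exp (-b ^ 2 / 2) / √(2 * Real.pi) ∂(Pr.map (history x j y F t)) := by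
        refine integral_mono_of_nonneg (Eventually.of_forall fun h => ?_) (integrable_const _)
          (Eventually.of_forall hbound)
        exact integral_nonneg fun u => le_max_right _ _
    _ = _ := by
        have := Measure.isProbabilityMeasure_map (μ := Pr) hH.aemeasurable
        simp

omit [MeasurableSpace S] in
lemma queryStd_le_one (hk : (Matrix.of k).PosSemidef) (hk1 : ∀ u v, k u v ≤ 1) (hσ : 0 < σ)
    (t : ℕ) (s : S) : queryStd w k σ x j t s ≤ 1 :=
  Real.sqrt_le_one.2 ((postCov_self_le_kernel hk hσ _ _).trans (hk1 _ _))

lemma integrable_queryStd (hk : (Matrix.of k).PosSemidef) (hk1 : ∀ u v, k u v ≤ 1) (hσ : 0 < σ)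
    (hrun : IsRun Pr w U k σ f ε F x P j y) (t : ℕ) :
    Integrable (queryStd w k σ x j t) Pr := by
  have hm : Measurable (queryStd w k σ x j t) := by
    have h1 : Measurable fun r : (𝒳 × Fin n) × Hist 𝒳 Ω n t =>
        √(postCov k σ (histQueries w r.2) (site w r.1) (site w r.1)) :=
      measurable_from_prod_countable_right fun a =>
        (measurable_postCov (w := w) (k := k) (σ := σ) (site w a) (site w a)).sqrt
    obtain ⟨q, hq, hqe⟩ := hrun.exists_query_eq t
    have h2 := h1.comp ((hq.comp (hrun.measurable_history_sample t)).prodMk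
      (hrun.measurable_history t))
    convert! h2 using 1
    ext s
    simp only [Function.comp, ← hqe]
    rfl
  refine Integrable.of_bound (C := 1) hm.aestronglyMeasurable (Eventually.of_forall fun s => ?_)
  have h0 : 0 ≤ queryStd w k σ x j t s := Real.sqrt_nonneg _
  rw [Real.norm_of_nonneg h0]
  exact queryStd_le_one hk hk1 hσ t s

-- The maximizers `xs` and `Ps` are arbitrary, possibly non-measurable functions; measurability
-- comes from `optValue`. The weights lie in `[0, 1]`, so the sum of the absolute site values
-- dominates.
omit [IsProbabilityMeasure Pr] in
lemma integrable_quadrature_optimal (hU : (U : Set (Fin n → ℝ)) ⊆ chiSqBall n ρ)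
    {f : Dom 𝒳 Ω → S → ℝ} (hf : ∀ u, Measurable (f u))
    (hfi : ∀ a, Integrable (fun s => siteValues w f s a) Pr)
    (hopt : ∀ s, IsRobustOptimal w U (fun u => f u s) (xs s) (Ps s)) :
    Integrable (fun s => quadrature w (fun u => f u s) (xs s) (Ps s)) Pr := by
  refine (integrable_finsetSum Finset.univ fun a _ => (hfi a).abs).mono' ?_
    (Eventually.of_forall fun s => ?_)
  · simp only [(hopt _).quadrature_eq]
    exact (measurable_optValue.comp (measurable_siteValues hf)).aestronglyMeasurable
  · have h := (hU ((hopt s).mem (xs s))).1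
    rw [quadrature, expect_eq_sum_siteWeight]
    exact abs_sum_siteWeight_mul_le h.1 h.2 _ _

lemma integrable_siteWeight_mul (hU : (U : Set (Fin n → ℝ)) ⊆ chiSqBall n ρ)
    (hrun : IsRun Pr w U k σ f ε F x P j y) (t : ℕ) (a : 𝒳 × Fin n) {g : S → ℝ}
    (hg : Integrable g Pr) :
    Integrable (fun s => siteWeight (x t s) (P t s (x t s)) a * g s) Pr := by
  obtain ⟨c, hc, hce⟩ := hrun.measurable_siteWeight t a
  refine hg.bdd_mul (c := 1) ?_ (Eventually.of_forall fun s => ?_)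
  · simp only [hce]
    exact (hc.comp (hrun.measurable_history_sample t)).aestronglyMeasurable
  · have h := (hU ((hrun.choose_x t s).mem (x t s))).1
    rw [Real.norm_of_nonneg (siteWeight_nonneg h.1 _ _)]
    exact siteWeight_le_one h.1 h.2 _ _

lemma integrable_quadrature_chosen (hU : (U : Set (Fin n → ℝ)) ⊆ chiSqBall n ρ)
    (hrun : IsRun Pr w U k σ f ε F x P j y) (t : ℕ) {g : Dom 𝒳 Ω → S → ℝ}
    (hg : ∀ a, Integrable (fun s => siteValues w g s a) Pr) :
    Integrable (fun s => quadrature w (fun u => g u s) (x t s) (P t s)) Pr := by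
  simp only [quadrature, expect_eq_sum_siteWeight]
  exact integrable_finsetSum _ fun a _ => hrun.integrable_siteWeight_mul hU t a (hg a)

lemma integrable_instRegret (hU : (U : Set (Fin n → ℝ)) ⊆ chiSqBall n ρ)
    (hrun : IsRun Pr w U k σ f ε F x P j y)
    (hopt : ∀ s, IsRobustOptimal w U (fun u => f u s) (xs s) (Ps s)) (t : ℕ) :
    Integrable (instRegret w f xs Ps x P t) Pr :=
  (integrable_quadrature_optimal hU hrun.measurable_f hrun.integrable_siteValues hopt).sub
    (hrun.integrable_quadrature_chosen hU t hrun.integrable_siteValues)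

/-- The expected regret of a round is the expected gap between the posterior sample and the
posterior mean at the chosen decision. -/
lemma integral_instRegret (hk : (Matrix.of k).PosSemidef) (hσ : 0 < σ)
    (hU : (U : Set (Fin n → ℝ)) ⊆ chiSqBall n ρ)
    (hrun : IsRun Pr w U k σ f ε F x P j y)
    (hopt : ∀ s, IsRobustOptimal w U (fun u => f u s) (xs s) (Ps s)) (t : ℕ) :
    ∫ s, instRegret w f xs Ps x P t s ∂Pr =
      ∫ s, ∑ a, siteWeight (x t s) (P t s (x t s)) a * (siteValues w (F t) s a -
        postMeanVec w k σ (site w) (history x j y F t s) a) ∂Pr := by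
  have hfs := hrun.integrable_siteValues (w := w)
  have hFs := hrun.integrable_siteValues_sample hk hσ (w := w) t
  have hms := hrun.integrable_postMeanVec hk hσ t
  -- Probability matching: the unknown optimum of `f` is exchanged for the optimum of `F t`, which
  -- is attained at the algorithm's own choice.
  have h1 : ∫ s, quadrature w (fun u => f u s) (xs s) (Ps s) ∂Pr =
      ∫ s, quadrature w (fun u => F t u s) (x t s) (P t s) ∂Pr := by
    simp only [(hopt _).quadrature_eq, (hrun.choose_x t _).quadrature_eq]
    rw [← integral_map (μ := Pr) (φ := siteValues w f) (f := optValue U)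
      (measurable_siteValues hrun.measurable_f).aemeasurable
      measurable_optValue.aestronglyMeasurable, hrun.map_siteValues_eq hk hσ t,
      integral_map (measurable_siteValues (hrun.measurable_F t)).aemeasurable
      measurable_optValue.aestronglyMeasurable]
  have h2 : ∀ a, ∫ s, siteWeight (x t s) (P t s (x t s)) a * siteValues w f s a ∂Pr =
      ∫ s, siteWeight (x t s) (P t s (x t s)) a *
        postMeanVec w k σ (site w) (history x j y F t s) a ∂Pr := fun a => by
    obtain ⟨c, hc, hce⟩ := hrun.measurable_siteWeight t a
    simp only [hce]
    refine (hrun.integral_mul_siteValues hk hσ t a hc (M := 1) fun s => ?_).2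
    have h := (hU ((hrun.choose_x t s).mem (x t s))).1
    rw [← hce, abs_of_nonneg (siteWeight_nonneg h.1 _ _)]
    exact siteWeight_le_one h.1 h.2 _ _
  have h3 : ∀ a, Integrable (fun s => siteWeight (x t s) (P t s (x t s)) a *
      siteValues w (F t) s a - siteWeight (x t s) (P t s (x t s)) a *
      postMeanVec w k σ (site w) (history x j y F t s) a) Pr := fun a =>
    (hrun.integrable_siteWeight_mul hU t a (hFs a)).sub
      (hrun.integrable_siteWeight_mul hU t a (hms a))
  unfold instRegret
  rw [integral_sub (integrable_quadrature_optimal hU hrun.measurable_f hfs hopt)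
    (hrun.integrable_quadrature_chosen hU t hfs), h1]
  simp only [quadrature, expect_eq_sum_siteWeight, mul_sub]
  rw [integral_finsetSum _ fun a _ => hrun.integrable_siteWeight_mul hU t a (hfs a),
    integral_finsetSum _ fun a _ => hrun.integrable_siteWeight_mul hU t a (hFs a),
    integral_finsetSum _ fun a _ => h3 a, ← Finset.sum_sub_distrib]
  refine Finset.sum_congr rfl fun a _ => ?_
  rw [integral_sub (hrun.integrable_siteWeight_mul hU t a (hFs a))
    (hrun.integrable_siteWeight_mul hU t a (hms a)), h2]

/-- The expected regret of a round. -/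
lemma integral_instRegret_le (hk : (Matrix.of k).PosSemidef) (hk1 : ∀ u v, k u v ≤ 1)
    (hσ : 0 < σ) (hU : (U : Set (Fin n → ℝ)) ⊆ chiSqBall n ρ)
    (hrun : IsRun Pr w U k σ f ε F x P j y)
    (hopt : ∀ s, IsRobustOptimal w U (fun u => f u s) (xs s) (Ps s)) (t : ℕ) {b : ℝ}
    (hb : 0 ≤ b) :
    ∫ s, instRegret w f xs Ps x P t s ∂Pr ≤ b * ∫ s, queryStd w k σ x j t s ∂Pr +
      𝒳.card * U.card * (Real.exp (-b ^ 2 / 2) / √(2 * Real.pi)) := by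
  have hFs := hrun.integrable_siteValues_sample hk hσ (w := w) t
  have hms := hrun.integrable_postMeanVec hk hσ t
  have hq := hrun.integrable_queryStd hk hk1 hσ t
  have hs : ∀ p : U, (∀ i, 0 ≤ (p : Fin n → ℝ) i) ∧ ∑ i, (p : Fin n → ℝ) i = 1 :=
    fun p => (hU p.2).1
  -- The chosen pair depends on the sample, so the excess over `b` standard deviations is summed
  -- over all fixed pairs, for each of which the Gaussian estimate is valid.
  let G : 𝒳 → U → S → ℝ := fun x' p s => max (∑ a, siteWeight x' p a * (siteValues w (F t) s a -
      postMeanVec w k σ (site w) (history x j y F t s) a) -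
      b * √(siteWeight x' p ⬝ᵥ (gram (postCov k σ (queries w x j t s)) (site w) *ᵥ
        siteWeight x' p))) 0
  have hG : ∀ x' p, Integrable (G x' p) Pr ∧
      ∫ s, G x' p s ∂Pr ≤ Real.exp (-b ^ 2 / 2) / √(2 * Real.pi) := fun x' p =>
    hrun.integral_posPart_le hk hk1 hσ t x' (hs p).1 (hs p).2 hb
  have hGi : Integrable (fun s => ∑ x', ∑ p, G x' p s) Pr :=
    integrable_finsetSum _ fun x' _ => integrable_finsetSum _ fun p _ => (hG x' p).1
  have hpt : ∀ s, ∑ a, siteWeight (x t s) (P t s (x t s)) a * (siteValues w (F t) s a -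
        postMeanVec w k σ (site w) (history x j y F t s) a) ≤
      b * queryStd w k σ x j t s + ∑ x', ∑ p, G x' p s := by
    intro s
    let p : U := ⟨P t s (x t s), (hrun.choose_x t s).mem (x t s)⟩
    have h1 : G (x t s) p s ≤ ∑ x', ∑ p, G x' p s :=
      (Finset.single_le_sum (f := fun p => G (x t s) p s) (fun _ _ => le_max_right _ _)
        (Finset.mem_univ p)).trans
        (Finset.single_le_sum (f := fun x' => ∑ p, G x' p s)
          (fun _ _ => Finset.sum_nonneg fun _ _ => le_max_right _ _) (Finset.mem_univ _))
    -- The weights live on the sites above `x t`, where the queried sample has the largest posterior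
    -- variance.
    have h2 : √(siteWeight (x t s) p ⬝ᵥ (gram (postCov k σ (queries w x j t s)) (site w) *ᵥ
        siteWeight (x t s) p)) ≤ queryStd w k σ x j t s := by
      classical
      refine Real.sqrt_le_sqrt (dotProduct_mulVec_le (gram_postCov_posSemidef hk hσ _ _)
        (siteWeight_nonneg (hs p).1 _) (sum_siteWeight (hs p).2 _) fun a ha => ?_)
      have hax : a.1 = x t s := by
        by_contra hne
        exact ha (by simp [siteWeight, hne])
      have := hrun.choose_w t s a.2
      rw [← hax] at this ⊢
      exact this
    have h3 := le_max_left (∑ a, siteWeight (x t s) p a * (siteValues w (F t) s a -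
      postMeanVec w k σ (site w) (history x j y F t s) a) -
      b * √(siteWeight (x t s) p ⬝ᵥ (gram (postCov k σ (queries w x j t s)) (site w) *ᵥ
        siteWeight (x t s) p))) 0
    have h4 := mul_le_mul_of_nonneg_left h2 hb
    have h5 := h3.trans h1
    have h6 : (p : Fin n → ℝ) = P t s (x t s) := rfl
    rw [h6] at h4 h5
    linarith
  rw [integral_instRegret hk hσ hU hrun hopt t]
  calc _ ≤ ∫ s, (b * queryStd w k σ x j t s + ∑ x', ∑ p, G x' p s) ∂Pr :=
        integral_mono (integrable_finsetSum _ fun a _ => hrun.integrable_siteWeight_mul hU t a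
          ((hFs a).sub (hms a))) ((hq.const_mul b).add hGi) hpt
    _ = b * ∫ s, queryStd w k σ x j t s ∂Pr + ∑ x', ∑ p, ∫ s, G x' p s ∂Pr := by
        rw [integral_add (hq.const_mul b) hGi, integral_const_mul, integral_finsetSum _ fun x' _ =>
          integrable_finsetSum _ fun p _ => (hG x' p).1]
        congr 1
        exact Finset.sum_congr rfl fun x' _ => integral_finsetSum _ fun p _ => (hG x' p).1
    _ ≤ _ := by
        gcongr
        refine (Finset.sum_le_sum fun x' _ => Finset.sum_le_sum fun p _ => (hG x' p).2).trans_eq ?_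
        simp [mul_assoc]

end IsRun

end Run

/-! ### Gaussian product densities and diagonalization -/

section GaussianDensity

variable {ι : Type*} [Fintype ι]

/-- The density of independent centred Gaussian variables. -/
noncomputable def gaussianProdPDF (v : ι → NNReal) (e : ι → ℝ) : ℝ :=
  ∏ i, gaussianPDFReal 0 (v i) (e i)

lemma gaussianProdPDF_pos {v : ι → NNReal} (hv : ∀ i, v i ≠ 0) (e : ι → ℝ) :
    0 < gaussianProdPDF v e :=
  Finset.prod_pos fun i _ => gaussianPDFReal_pos _ _ _ (hv i)

lemma measurable_gaussianProdPDF (v : ι → NNReal) : Measurable (gaussianProdPDF v) := by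
  unfold gaussianProdPDF
  fun_prop

lemma log_gaussianPDFReal {v : NNReal} (hv : v ≠ 0) (e : ℝ) :
    Real.log (gaussianPDFReal 0 v e) =
      -(1 / 2) * Real.log (2 * Real.pi) - (1 / 2) * Real.log v - e ^ 2 / (2 * v) := by
  have hv' : (0 : ℝ) < v := by positivity
  rw [gaussianPDFReal, Real.log_mul (by positivity) (by positivity), Real.log_exp, Real.log_inv,
    Real.log_sqrt (by positivity), Real.log_mul (by positivity) (by positivity)]
  ring_nf

lemma log_gaussianProdPDF {v : ι → NNReal} (hv : ∀ i, v i ≠ 0) (e : ι → ℝ) :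
    Real.log (gaussianProdPDF v e) =
      ∑ i, (-(1 / 2) * Real.log (2 * Real.pi) - (1 / 2) * Real.log (v i) -
        e i ^ 2 / (2 * v i)) := by
  rw [gaussianProdPDF, Real.log_prod fun i _ => (gaussianPDFReal_pos _ _ _ (hv i)).ne']
  exact Finset.sum_congr rfl fun i _ => log_gaussianPDFReal (hv i) _

lemma pi_gaussianReal_eq_withDensity {v : ι → NNReal} (hv : ∀ i, v i ≠ 0) :
    Measure.pi (fun i => gaussianReal 0 (v i)) =
      volume.withDensity fun e => ENNReal.ofReal (gaussianProdPDF v e) := by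
  refine Measure.pi_eq fun s hs => ?_
  rw [withDensity_apply _ (MeasurableSet.univ_pi hs), volume_pi, Measure.restrict_pi_pi,
    ← ofReal_integral_eq_lintegral_ofReal]
  · unfold gaussianProdPDF
    rw [integral_fintype_prod_eq_prod (f := fun i => gaussianPDFReal 0 (v i)),
      ENNReal.ofReal_prod_of_nonneg fun i _ =>
        integral_nonneg fun _ => gaussianPDFReal_nonneg _ _ _]
    exact Finset.prod_congr rfl fun i _ => (gaussianReal_apply_eq_integral 0 (hv i) (s i)).symm
  · exact Integrable.fintype_prod fun i => (integrable_gaussianPDFReal 0 (v i)).restrict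
  · exact Eventually.of_forall fun e => (gaussianProdPDF_pos hv e).le

lemma integral_eval_pi_gaussianReal (v : ι → NNReal) (φ : ℝ → ℝ) (hφ : Measurable φ) (a : ι) :
    ∫ e, φ (e a) ∂(Measure.pi fun i => gaussianReal 0 (v i)) =
      ∫ r, φ r ∂(gaussianReal 0 (v a)) := by
  rw [← (measurePreserving_eval (fun i => gaussianReal 0 (v i)) a).map_eq,
    integral_map (measurable_pi_apply a).aemeasurable hφ.aestronglyMeasurable]

lemma integral_coord_pi_gaussianReal (v : ι → NNReal) (a : ι) :
    ∫ e, e a ∂(Measure.pi fun i => gaussianReal 0 (v i)) = 0 :=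
  (integral_eval_pi_gaussianReal v id measurable_id a).trans integral_id_gaussianReal

lemma memLp_eval_pi_gaussianReal (v : ι → NNReal) (a : ι) :
    MemLp (fun e : ι → ℝ => e a) 2 (Measure.pi fun i => gaussianReal 0 (v i)) :=
  (memLp_id_gaussianReal' 2 (by simp)).comp_measurePreserving
    (measurePreserving_eval (fun i => gaussianReal 0 (v i)) a)

lemma integral_sq_gaussianReal (v : NNReal) : ∫ r, r ^ 2 ∂(gaussianReal 0 v) = v := by
  rw [← variance_id_gaussianReal (μ := 0) (v := v), variance_of_integral_eq_zero aemeasurable_id]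
  · rfl
  · exact integral_id_gaussianReal

lemma covariance_eval_pi_gaussianReal [DecidableEq ι] (v : ι → NNReal) (a b : ι) :
    cov[fun e => e a, fun e => e b; Measure.pi fun i => gaussianReal 0 (v i)] =
      if a = b then (v a : ℝ) else 0 := by
  split_ifs with h
  · subst h
    rw [covariance_self (measurable_pi_apply a).aemeasurable,
      variance_of_integral_eq_zero (measurable_pi_apply a).aemeasurable]
    · rw [← integral_sq_gaussianReal (v a),
        ← integral_eval_pi_gaussianReal v (fun r => r ^ 2) (by fun_prop)]
    · exact integral_coord_pi_gaussianReal v a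
  · have h1 := iIndepFun_pi (𝓧 := fun _ : ι => ℝ) (μ := fun i => gaussianReal 0 (v i))
      (X := fun _ => id)
      (fun i => aemeasurable_id)
    exact (h1.indepFun h).covariance_eq_zero (memLp_eval_pi_gaussianReal v a)
      (memLp_eval_pi_gaussianReal v b)

lemma hasGaussianLaw_pi_gaussianReal (v : ι → NNReal) :
    HasGaussianLaw (fun e : ι → ℝ => e) (Measure.pi fun i => gaussianReal 0 (v i)) := by
  have h1 : iIndepFun (fun i (e : ι → ℝ) => e i) (Measure.pi fun i => gaussianReal 0 (v i)) :=
    iIndepFun_pi (X := fun _ => id) (μ := fun i => gaussianReal 0 (v i))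
      fun i => (aemeasurable_id : AEMeasurable id (gaussianReal 0 (v i)))
  refine iIndepFun.hasGaussianLaw (fun i => ⟨?_⟩) h1
  change IsGaussian (Measure.map (Function.eval i) (Measure.pi fun i => gaussianReal 0 (v i)))
  rw [(measurePreserving_eval (fun i => gaussianReal 0 (v i)) i).map_eq]
  infer_instance

/-- A centred Gaussian vector with positive definite covariance in an eigenbasis. -/
lemma map_pi_gaussianReal_eigenvectors [DecidableEq ι] {M : Matrix ι ι ℝ} (hM : M.PosDef)
    (v : ι → NNReal) (hv : ∀ i, (v i : ℝ) = hM.isHermitian.eigenvalues i) :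
    (Measure.pi fun i => gaussianReal 0 (v i)).map
      (fun e => WithLp.toLp 2 ((hM.isHermitian.eigenvectorUnitary : Matrix ι ι ℝ) *ᵥ e)) =
      multivariateGaussian 0 M := by
  set V : Matrix ι ι ℝ := (hM.isHermitian.eigenvectorUnitary : Matrix ι ι ℝ) with hV
  set N := Measure.pi fun i => gaussianReal 0 (v i)
  have hmeas : Measurable fun e : ι → ℝ => WithLp.toLp 2 (V *ᵥ e) := by
    unfold Matrix.mulVec dotProduct
    fun_prop
  have hmul : ∀ e i, (V *ᵥ e) i = ∑ a, V i a * e a := fun _ _ => rfl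
  have hent : ∀ a b, M a b = ∑ c, V a c * v c * V b c := fun a b => by
    have h := congrFun (congrFun hM.isHermitian.spectral_theorem a) b
    rw [h, Unitary.conjStarAlgAut_apply, Matrix.mul_apply]
    simp [Matrix.mul_diagonal, hv, hV, Matrix.star_apply]
  have : IsGaussian (N.map fun e => WithLp.toLp 2 (V *ᵥ e)) :=
    (((hasGaussianLaw_pi_gaussianReal v).map_fun
      (LinearMap.toContinuousLinearMap (Matrix.toLin' V))).toLp_pi 2).isGaussian_map
  refine eq_multivariateGaussian hM.posSemidef (fun i => ?_) fun i j => ?_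
  · rw [integral_map hmeas.aemeasurable (by fun_prop)]
    simp only [hmul]
    rw [integral_finsetSum _ fun a _ =>
      ((memLp_eval_pi_gaussianReal v a).integrable (by simp)).const_mul _]
    refine Finset.sum_eq_zero fun a _ => ?_
    rw [integral_const_mul, integral_coord_pi_gaussianReal, mul_zero]
  · rw [covariance_map_fun (by fun_prop) (by fun_prop) hmeas.aemeasurable]
    simp only [hmul]
    rw [covariance_fun_sum_fun_sum (fun a => (memLp_eval_pi_gaussianReal v a).const_mul _)
      (fun a => (memLp_eval_pi_gaussianReal v a).const_mul _), hent]
    refine Finset.sum_congr rfl fun a _ => ?_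
    have hc : ∀ b, cov[fun e => V i a * e a, fun e => V j b * e b; N] =
        V i a * (V j b * if a = b then (v a : ℝ) else 0) := fun b => by
      rw [covariance_const_mul_left, covariance_const_mul_right, covariance_eval_pi_gaussianReal]
    refine (Finset.sum_congr rfl fun b _ => hc b).trans ?_
    simp
    ring

/-- A Gaussian vector plus independent noise. -/
lemma map_add_noise [DecidableEq ι] {K : Matrix ι ι ℝ} (hK : K.PosSemidef) (τ : NNReal) :
    ((multivariateGaussian 0 K).prod (Measure.pi fun _ : ι => gaussianReal 0 τ)).map
      (fun p => WithLp.toLp 2 fun i => p.1 i + p.2 i) =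
      multivariateGaussian 0 (K + (τ : ℝ) • (1 : Matrix ι ι ℝ)) := by
  set N := Measure.pi fun _ : ι => gaussianReal 0 τ with hN
  set Q := (multivariateGaussian 0 K).prod N with hQ
  have hPS : (K + (τ : ℝ) • (1 : Matrix ι ι ℝ)).PosSemidef :=
    hK.add (Matrix.PosSemidef.one.smul τ.2)
  have hGN : IsGaussian N := by
    simpa using (hasGaussianLaw_pi_gaussianReal fun _ : ι => τ).isGaussian_map
  have hA : ∀ i, MemLp (fun p : EuclideanSpace ℝ ι × (ι → ℝ) => p.1 i) 2 Q := fun i =>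
    (memLp_eval_multivariateGaussian 0 K i).comp_measurePreserving measurePreserving_fst
  have hE : ∀ i, MemLp (fun p : EuclideanSpace ℝ ι × (ι → ℝ) => p.2 i) 2 Q := fun i =>
    (memLp_eval_pi_gaussianReal (fun _ => τ) i).comp_measurePreserving measurePreserving_snd
  have hmeas : Measurable fun p : EuclideanSpace ℝ ι × (ι → ℝ) =>
    WithLp.toLp 2 fun i => p.1 i + p.2 i := by fun_prop
  let L : EuclideanSpace ℝ ι × (ι → ℝ) →L[ℝ] (ι → ℝ) := ContinuousLinearMap.pi fun i =>
    (EuclideanSpace.proj (𝕜 := ℝ) i).comp (ContinuousLinearMap.fst ℝ _ _) +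
      (ContinuousLinearMap.proj (R := ℝ) (φ := fun _ : ι => ℝ) i).comp
        (ContinuousLinearMap.snd ℝ _ _)
  have : IsGaussian (Q.map fun p => WithLp.toLp 2 fun i => p.1 i + p.2 i) :=
    (((IsGaussian.hasGaussianLaw_id (μ := Q)).map_fun L).toLp_pi 2).isGaussian_map
  refine eq_multivariateGaussian hPS (fun i => ?_) fun i j => ?_
  · rw [integral_map hmeas.aemeasurable (by fun_prop)]
    simp only
    rw [integral_add ((hA i).integrable (by simp)) ((hE i).integrable (by simp)), hQ,
      integral_fun_fst (fun a : EuclideanSpace ℝ ι => a i), integral_fun_snd (fun e : ι → ℝ => e i),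
      integral_eval_multivariateGaussian, hN, integral_coord_pi_gaussianReal]
    simp
  · rw [covariance_map_fun (by fun_prop) (by fun_prop) hmeas.aemeasurable]
    simp only
    have h1 : cov[fun p => p.1 i, fun p => p.1 j; Q] = K i j := by
      rw [← covariance_eval_multivariateGaussian (μ := 0) hK i j,
        ← (measurePreserving_fst (μ := multivariateGaussian 0 K) (ν := N)).map_eq,
        covariance_map_fun] <;> first | rfl | fun_prop
    have h2 : cov[fun p => p.2 i, fun p => p.2 j; Q] = if i = j then (τ : ℝ) else 0 := by
      rw [← covariance_eval_pi_gaussianReal (fun _ => τ) i j,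
        ← hN,
        ← (measurePreserving_snd (μ := multivariateGaussian 0 K) (ν := N)).map_eq,
        covariance_map_fun] <;> first | rfl | fun_prop | exact
          (measurable_pi_apply _).aestronglyMeasurable
    have h3 : ∀ i j, cov[fun p => p.1 i, fun p => p.2 j; Q] = 0 := fun i j =>
      covariance_fst_snd_prod (memLp_eval_multivariateGaussian 0 K i)
        (memLp_eval_pi_gaussianReal (fun _ => τ) j)
    rw [show (fun p : EuclideanSpace ℝ ι × (ι → ℝ) => p.1 i + p.2 i) =
        (fun p => p.1 i) + fun p => p.2 i from rfl,
      show (fun p : EuclideanSpace ℝ ι × (ι → ℝ) => p.1 j + p.2 j) =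
        (fun p => p.1 j) + fun p => p.2 j from rfl,
      covariance_add_left (hA i) (hE i) ((hA j).add (hE j)),
      covariance_add_right (hA i) (hA j) (hE j), covariance_add_right (hE i) (hA j) (hE j),
      h1, h2, h3, covariance_comm, h3]
    simp [Matrix.one_apply]

end GaussianDensity

/-! ### Mutual information of a Gaussian vector and its noisy observation -/

section Information

variable {ι : Type*} [Fintype ι]

/-- The density of a centred Gaussian vector with positive definite covariance. -/
lemma map_ofLp_multivariateGaussian_eq_withDensity [DecidableEq ι] {M : Matrix ι ι ℝ}
    (hM : M.PosDef) (v : ι → NNReal) (hv : ∀ i, (v i : ℝ) = hM.isHermitian.eigenvalues i) :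
    (multivariateGaussian 0 M).map WithLp.ofLp = volume.withDensity fun y =>
      ENNReal.ofReal (gaussianProdPDF v
        ((hM.isHermitian.eigenvectorUnitary : Matrix ι ι ℝ)ᵀ *ᵥ y)) := by
  have hv0 : ∀ i, v i ≠ 0 := fun i h => by
    have := hM.eigenvalues_pos i
    rw [← hv i, h] at this
    simp at this
  rw [← map_pi_gaussianReal_eigenvectors hM v hv]
  set V : Matrix ι ι ℝ := (hM.isHermitian.eigenvectorUnitary : Matrix ι ι ℝ) with hV
  have hVV : Vᵀ * V = 1 := by
    have := (Matrix.mem_unitaryGroup_iff' (A := V)).1 hM.isHermitian.eigenvectorUnitary.2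
    simpa [Matrix.star_eq_conjTranspose] using this
  have hdet : V.det * V.det = 1 := by
    have := congrArg Matrix.det hVV
    simpa using this
  have habs : |V.det⁻¹| = 1 := by
    rw [abs_inv, inv_eq_one]
    nlinarith [abs_nonneg V.det, abs_mul_abs_self V.det]
  have hmeas : Measurable fun e : ι → ℝ => V *ᵥ e := by
    unfold Matrix.mulVec dotProduct
    fun_prop
  have hmeas' : Measurable fun e : ι → ℝ => Vᵀ *ᵥ e := by
    unfold Matrix.mulVec dotProduct
    fun_prop
  -- An orthogonal change of variables has determinant of absolute value one and preserves Lebesgue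
  -- measure.
  have hvol : (volume : Measure (ι → ℝ)).map (fun e => V *ᵥ e) = volume := by
    have h := Real.map_matrix_volume_pi_eq_smul_volume_pi (M := V)
      (fun h => by simp [h] at hdet)
    rw [habs] at h
    rw [ENNReal.ofReal_one, one_smul] at h
    exact h
  rw [Measure.map_map (by fun_prop) (by fun_prop)]
  refine Measure.ext_of_lintegral _ fun φ hφ => ?_
  have hd : Measurable fun y => ENNReal.ofReal (gaussianProdPDF v (Vᵀ *ᵥ y)) :=
    ((measurable_gaussianProdPDF v).comp hmeas').ennreal_ofReal
  rw [lintegral_map hφ (by fun_prop), lintegral_withDensity_eq_lintegral_mul _ hd hφ,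
    pi_gaussianReal_eq_withDensity hv0, lintegral_withDensity_eq_lintegral_mul _
      (measurable_gaussianProdPDF v).ennreal_ofReal (by fun_prop)]
  conv_rhs => rw [← hvol, lintegral_map (by fun_prop) hmeas]
  refine lintegral_congr fun e => ?_
  simp [Matrix.mulVec_mulVec, hVV]

variable {Z : Type*} {k : Z → Z → ℝ} {σ : ℝ} {T : ℕ}

lemma measurable_obs : Measurable fun p : EuclideanSpace ℝ (Fin T) × (Fin T → ℝ) =>
    (p.1, fun i => p.1 i + p.2 i) := by
  fun_prop

instance isProbabilityMeasure_obsLaw (z : Fin T → Z) : IsProbabilityMeasure (obsLaw k σ z) :=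
  Measure.isProbabilityMeasure_map measurable_obs.aemeasurable

lemma fst_obsLaw (z : Fin T → Z) : (obsLaw k σ z).fst = multivariateGaussian 0 (gram k z) := by
  rw [obsLaw, Measure.fst, Measure.map_map measurable_fst measurable_obs]
  exact Measure.fst_prod

lemma snd_obsLaw (hk : (Matrix.of k).PosSemidef) (z : Fin T → Z) :
    (obsLaw k σ z).snd = (multivariateGaussian 0
      (gram k z + σ ^ 2 • (1 : Matrix (Fin T) (Fin T) ℝ))).map WithLp.ofLp := by
  have h := map_add_noise (gram_posSemidef hk z) (σ ^ 2).toNNReal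
  rw [Real.coe_toNNReal _ (sq_nonneg σ)] at h
  rw [← h, obsLaw, Measure.snd, Measure.map_map measurable_snd measurable_obs,
    Measure.map_map (by fun_prop) (by fun_prop)]
  rfl

/-- Given the signal, the observation is translated noise. The Gram matrix may be singular, so the
signal need not have a density: the reference measure is the law of the signal times Lebesgue
measure. -/
lemma obsLaw_eq_withDensity (hσ : 0 < σ) (z : Fin T → Z) :
    obsLaw k σ z = ((multivariateGaussian 0 (gram k z)).prod
      (volume : Measure (Fin T → ℝ))).withDensity fun p =>
      ENNReal.ofReal
        (gaussianProdPDF (fun _ : Fin T => (σ ^ 2).toNNReal) fun i => p.2 i - p.1 i) := by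
  have hτ : (σ ^ 2).toNNReal ≠ 0 := by simp [hσ.ne']
  have hd := measurable_gaussianProdPDF fun _ : Fin T => (σ ^ 2).toNNReal
  have hd' : Measurable fun p : EuclideanSpace ℝ (Fin T) × (Fin T → ℝ) =>
      ENNReal.ofReal (gaussianProdPDF (fun _ => (σ ^ 2).toNNReal) fun i => p.2 i - p.1 i) :=
    (hd.comp (by fun_prop)).ennreal_ofReal
  refine Measure.ext_of_lintegral _ fun φ hφ => ?_
  rw [obsLaw, lintegral_map hφ measurable_obs, lintegral_withDensity_eq_lintegral_mul _ hd' hφ,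
    lintegral_prod (fun p : EuclideanSpace ℝ (Fin T) × (Fin T → ℝ) =>
      φ (p.1, fun i => p.1 i + p.2 i)) (hφ.comp measurable_obs).aemeasurable,
    lintegral_prod _ (hd'.mul hφ).aemeasurable]
  refine lintegral_congr fun a => ?_
  rw [pi_gaussianReal_eq_withDensity fun _ => hτ, lintegral_withDensity_eq_lintegral_mul _
      hd.ennreal_ofReal (by fun_prop)]
  conv_rhs => rw [← lintegral_add_right_eq_self _ (a : Fin T → ℝ)]
  refine lintegral_congr fun e => ?_
  simp [Pi.add_def, add_comm]

/-- The mutual information of a Gaussian vector and its noisy observation. -/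
lemma toReal_mutualInfo_obsLaw (hk : (Matrix.of k).PosSemidef) (hσ : 0 < σ) (z : Fin T → Z) :
    (mutualInfo (obsLaw k σ z)).toReal =
      (1 / 2) * (Real.log (gram k z + σ ^ 2 • (1 : Matrix (Fin T) (Fin T) ℝ)).det -
        T * Real.log (σ ^ 2)) := by
  have hM := noisyGram_posDef hk hσ z
  set M := gram k z + σ ^ 2 • (1 : Matrix (Fin T) (Fin T) ℝ) with hMdef
  set V : Matrix (Fin T) (Fin T) ℝ := (hM.isHermitian.eigenvectorUnitary :
    Matrix (Fin T) (Fin T) ℝ) with hV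
  set τ := (σ ^ 2).toNNReal with hτdef
  have hτσ : (τ : ℝ) = σ ^ 2 := Real.coe_toNNReal _ (sq_nonneg σ)
  have hτ : τ ≠ 0 := by simp [hτdef, hσ.ne']
  let v : Fin T → NNReal := fun i => (hM.isHermitian.eigenvalues i).toNNReal
  have hv : ∀ i, (v i : ℝ) = hM.isHermitian.eigenvalues i := fun i =>
    Real.coe_toNNReal _ (hM.eigenvalues_pos i).le
  have hv0 : ∀ i, v i ≠ 0 := fun i h => by
    have := hM.eigenvalues_pos i
    rw [← hv i, h] at this
    simp at this
  have hVV : Vᵀ * V = 1 := by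
    have := (Matrix.mem_unitaryGroup_iff' (A := V)).1 hM.isHermitian.eigenvectorUnitary.2
    simpa [Matrix.star_eq_conjTranspose] using this
  set ν := obsLaw k σ z with hν
  set μ := multivariateGaussian 0 (gram k z) with hμ
  set p : EuclideanSpace ℝ (Fin T) × (Fin T → ℝ) → ℝ := fun q =>
    gaussianProdPDF (fun _ => τ) fun i => q.2 i - q.1 i with hp
  set r : (Fin T → ℝ) → ℝ := fun y => gaussianProdPDF v (Vᵀ *ᵥ y) with hr
  have hmeas' : Measurable fun e : Fin T → ℝ => Vᵀ *ᵥ e := by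
    unfold Matrix.mulVec dotProduct
    fun_prop
  have hpm : Measurable p := (measurable_gaussianProdPDF _).comp (by fun_prop)
  have hrm : Measurable r := (measurable_gaussianProdPDF _).comp hmeas'
  have hp0 : ∀ q, 0 < p q := fun q => gaussianProdPDF_pos (fun _ => hτ) _
  have hr0 : ∀ y, 0 < r y := fun y => gaussianProdPDF_pos hv0 _
  have hsnd : ν.snd = volume.withDensity fun y => ENNReal.ofReal (r y) := by
    rw [hν, snd_obsLaw hk, map_ofLp_multivariateGaussian_eq_withDensity hM v hv]
  have hprod : ν.fst.prod ν.snd = (μ.prod volume).withDensity fun q => ENNReal.ofReal (r q.2) := by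
    rw [hsnd, hν, fst_obsLaw, prod_withDensity_right hrm.ennreal_ofReal]
  have hr2 : Measurable fun q : EuclideanSpace ℝ (Fin T) × (Fin T → ℝ) =>
    ENNReal.ofReal (r q.2) := (hrm.comp measurable_snd).ennreal_ofReal
  set π := ν.fst.prod ν.snd with hπ
  have hfm : Measurable fun q => ENNReal.ofReal (p q / r q.2) :=
    (hpm.div (hrm.comp measurable_snd)).ennreal_ofReal
  -- Both the joint law and the product of marginals have densities for the same reference measure,
  -- so the signal law drops out of the likelihood ratio.
  have hratio : ν = π.withDensity fun q => ENNReal.ofReal (p q / r q.2) := by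
    rw [hprod, ← withDensity_mul _ hr2 hfm, hν,
      obsLaw_eq_withDensity hσ]
    congr 1
    ext q
    rw [Pi.mul_apply, ← ENNReal.ofReal_mul (hr0 _).le, mul_div_cancel₀ _ (hr0 _).ne']
  have hac : ν ≪ π := by
    conv_lhs => rw [hratio]
    exact withDensity_absolutelyContinuous _ _
  have hllr : llr ν π =ᵐ[ν] fun q => Real.log (p q) - Real.log (r q.2) := by
    have h := Measure.rnDeriv_withDensity π hfm
    rw [← hratio] at h
    filter_upwards [hac.ae_le h] with q hq
    rw [llr, hq, ENNReal.toReal_ofReal (div_pos (hp0 _) (hr0 _)).le,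
      Real.log_div (hp0 _).ne' (hr0 _).ne']
  have hνmap : ν = (μ.prod (Measure.pi fun _ => gaussianReal 0 τ)).map
      fun p => (p.1, fun i => p.1 i + p.2 i) := rfl
  have hnoise : ∀ i, Integrable (fun q => (q.2 i - q.1 i) ^ 2) ν ∧
      ∫ q, (q.2 i - q.1 i) ^ 2 ∂ν = τ := fun i => by
    have hsm : ∀ m, AEStronglyMeasurable (fun q : EuclideanSpace ℝ (Fin T) × (Fin T → ℝ) =>
      (q.2 i - q.1 i) ^ 2) m := fun m => by fun_prop
    rw [hνmap, integrable_map_measure (hsm _) measurable_obs.aemeasurable,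
      integral_map measurable_obs.aemeasurable (hsm _)]
    simp only [Function.comp_def, add_sub_cancel_left]
    refine ⟨((memLp_eval_pi_gaussianReal (fun _ => τ) i).integrable_sq).comp_snd _, ?_⟩
    rw [integral_fun_snd (fun e : Fin T → ℝ => e i ^ 2),
      integral_eval_pi_gaussianReal (fun _ => τ) (fun a => a ^ 2) (by fun_prop),
      integral_sq_gaussianReal]
    simp
  have hsndmap : ν.snd = (Measure.pi fun i => gaussianReal 0 (v i)).map fun e => V *ᵥ e := by
    rw [hν, snd_obsLaw hk, ← map_pi_gaussianReal_eigenvectors hM v hv,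
      Measure.map_map (by fun_prop) (by fun_prop)]
    rfl
  have heig : ∀ i, Integrable (fun q => (Vᵀ *ᵥ q.2) i ^ 2) ν ∧
      ∫ q, (Vᵀ *ᵥ q.2) i ^ 2 ∂ν = v i := fun i => by
    have hm : Measurable fun y => (Vᵀ *ᵥ y) i ^ 2 :=
      ((measurable_pi_apply i).comp hmeas').pow_const 2
    have hVm : Measurable fun e : Fin T → ℝ => V *ᵥ e := by
      unfold Matrix.mulVec dotProduct
      fun_prop
    have h1 : Integrable (fun y => (Vᵀ *ᵥ y) i ^ 2) ν.snd ∧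
        ∫ y, (Vᵀ *ᵥ y) i ^ 2 ∂ν.snd = v i := by
      rw [hsndmap, integrable_map_measure hm.aestronglyMeasurable hVm.aemeasurable,
        integral_map hVm.aemeasurable hm.aestronglyMeasurable]
      simp only [Function.comp_def, Matrix.mulVec_mulVec, hVV, Matrix.one_mulVec]
      refine ⟨(memLp_eval_pi_gaussianReal v i).integrable_sq, ?_⟩
      rw [integral_eval_pi_gaussianReal v (fun a => a ^ 2) (by fun_prop),
        integral_sq_gaussianReal]
    rw [Measure.snd, integrable_map_measure hm.aestronglyMeasurable measurable_snd.aemeasurable,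
      integral_map measurable_snd.aemeasurable hm.aestronglyMeasurable] at h1
    exact h1
  have hlog : ∀ q, Real.log (p q) - Real.log (r q.2) =
      ∑ i, ((1 / 2) * (Real.log (v i) - Real.log τ) - (q.2 i - q.1 i) ^ 2 / (2 * τ) +
        (Vᵀ *ᵥ q.2) i ^ 2 / (2 * v i)) := fun q => by
    rw [hp, hr]
    simp only
    rw [log_gaussianProdPDF fun _ => hτ, log_gaussianProdPDF hv0, ← Finset.sum_sub_distrib]
    exact Finset.sum_congr rfl fun i _ => by ring
  rw [mutualInfo, InformationTheory.toReal_klDiv_of_measure_eq hac (by simp),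
    integral_congr_ae hllr]
  simp only [hlog]
  have hsub : ∀ i, Integrable (fun q => (1 / 2) * (Real.log (v i) - Real.log τ) -
      (q.2 i - q.1 i) ^ 2 / (2 * τ)) ν := fun i =>
    (integrable_const _).sub ((hnoise i).1.div_const _)
  have hint : ∀ i, Integrable (fun q => (1 / 2) * (Real.log (v i) - Real.log τ) -
      (q.2 i - q.1 i) ^ 2 / (2 * τ) + (Vᵀ *ᵥ q.2) i ^ 2 / (2 * v i)) ν := fun i =>
    (hsub i).add ((heig i).1.div_const _)
  rw [integral_finsetSum _ fun i _ => hint i]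
  -- Each normalized square, of the noise and of an eigencoordinate of the observation, has mean
  -- one; the two halves cancel and only the logarithms of the variances remain.
  have hterm : ∀ i, ∫ q, ((1 / 2) * (Real.log (v i) - Real.log τ) -
      (q.2 i - q.1 i) ^ 2 / (2 * τ) + (Vᵀ *ᵥ q.2) i ^ 2 / (2 * v i)) ∂ν =
      (1 / 2) * (Real.log (v i) - Real.log τ) := fun i => by
    have h1 : (v i : ℝ) ≠ 0 := by exact_mod_cast hv0 i
    have h2 : (τ : ℝ) ≠ 0 := by exact_mod_cast hτ
    rw [integral_add (hsub i) ((heig i).1.div_const _),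
      integral_sub (integrable_const _) ((hnoise i).1.div_const _),
      integral_div, integral_div, (hnoise i).2, (heig i).2]
    simp only [integral_const, probReal_univ, one_smul]
    field_simp
    ring
  simp only [hterm]
  rw [← Finset.mul_sum, Finset.sum_sub_distrib, hM.isHermitian.det_eq_prod_eigenvalues,
    Real.log_prod fun i _ => by simpa using (hM.eigenvalues_pos i).ne']
  simp [hv, hτσ]

end Information

/-! ### Elementary estimates for summing posterior standard deviations -/

lemma maxInfoGain_nonneg {d m n : ℕ} {𝒳 : Finset (EuclideanSpace ℝ (Fin d))}
    {Ω : Set (EuclideanSpace ℝ (Fin m))} (w : Fin n → Ω)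
    (k : Dom 𝒳 Ω → Dom 𝒳 Ω → ℝ) (σ : ℝ) (T : ℕ) :
    0 ≤ maxInfoGain w k σ T :=
  Real.iSup_nonneg fun _ => ENNReal.toReal_nonneg

/-- On `[0, 1]`, the concave function `a ↦ log (1 + c a)` lies above its chord. -/
lemma mul_log_one_add_le {a c : ℝ} (ha : 0 ≤ a) (ha1 : a ≤ 1) (hc : 0 ≤ c) :
    a * Real.log (1 + c) ≤ Real.log (1 + c * a) := by
  have h := strictConcaveOn_log_Ioi.concaveOn.2 (x := 1) (y := 1 + c) (by simp)
    (by simp; linarith) (sub_nonneg.2 ha1) ha (by ring)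
  simp only [smul_eq_mul, Real.log_one, mul_zero, zero_add] at h
  refine h.trans (le_of_eq ?_)
  ring_nf

/-- A bound on the posterior standard deviation at a location observed `q` times. -/
noncomputable def visitBound (σ : ℝ) (q : ℕ) : ℝ := if q = 0 then 1 else σ / √q

lemma tendsto_visitBound (σ : ℝ) : Tendsto (visitBound σ) atTop (𝓝 0) := by
  have h : Tendsto (fun q : ℕ => σ / √(q : ℝ)) atTop (𝓝 0) :=
    tendsto_const_nhds.div_atTop (Real.tendsto_sqrt_atTop.comp tendsto_natCast_atTop_atTop)
  refine h.congr' ?_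
  filter_upwards [eventually_ne_atTop 0] with q hq
  simp [visitBound, hq]

lemma visitBound_nonneg (hσ : 0 < σ) (q : ℕ) : 0 ≤ visitBound σ q := by
  unfold visitBound
  split_ifs <;> positivity

/-- Group the rounds by the location visited. At one location the number of earlier visits runs
through 0, 1, 2, …, once each. -/
lemma sum_visits_le {α : Type*} [Fintype α] [DecidableEq α] {φ : ℕ → ℝ} (hφ : ∀ q, 0 ≤ φ q)
    (a : ℕ → α) (T : ℕ) :
    ∑ t ∈ Finset.range T, φ ((Finset.range t).filter fun i => a i = a t).card ≤
      Fintype.card α * ∑ q ∈ Finset.range T, φ q := by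
  have key : ∀ c : α, ∑ t ∈ (Finset.range T).filter (fun t => a t = c),
      φ ((Finset.range t).filter fun i => a i = a t).card =
      ∑ q ∈ Finset.range ((Finset.range T).filter fun t => a t = c).card, φ q := fun c => by
    induction T with
    | zero => simp
    | succ T ih =>
      rw [Finset.range_add_one, Finset.filter_insert]
      split_ifs with h
      · rw [Finset.sum_insert (by simp), Finset.card_insert_of_notMem (by simp),
          Finset.sum_range_succ, ih, h, add_comm]
      · exact ih
  calc _ = ∑ c, ∑ t ∈ (Finset.range T).filter (fun t => a t = c),
        φ ((Finset.range t).filter fun i => a i = a t).card :=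
        (Finset.sum_fiberwise _ _ _).symm
    _ ≤ ∑ _c : α, ∑ q ∈ Finset.range T, φ q := by
        refine Finset.sum_le_sum fun c _ => ?_
        rw [key c]
        refine Finset.sum_le_sum_of_subset_of_nonneg ?_ fun q _ _ => hφ q
        rw [Finset.range_subset_range]
        exact (Finset.card_filter_le _ _).trans (by simp)
    _ = _ := by simp

/-! ### Summation over rounds and the two regret bounds -/

namespace IsRun

variable {d m n : ℕ} {𝒳 : Finset (EuclideanSpace ℝ (Fin d))} {Ω : Set (EuclideanSpace ℝ (Fin m))}
  {w : Fin n → Ω} {k : Dom 𝒳 Ω → Dom 𝒳 Ω → ℝ} {σ : ℝ} {U : Finset (Fin n → ℝ)} {ρ : ℝ}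
  {S : Type*} [MeasurableSpace S] {Pr : Measure S} [IsProbabilityMeasure Pr]
  {f : Dom 𝒳 Ω → S → ℝ} {ε : ℕ → S → ℝ} {F : ℕ → Dom 𝒳 Ω → S → ℝ}
  {x : ℕ → S → 𝒳} {P : ℕ → S → 𝒳 → Fin n → ℝ} {j : ℕ → S → Fin n} {y : ℕ → S → ℝ}
  {xs : S → 𝒳} {Ps : S → 𝒳 → Fin n → ℝ}

/-- Tower property: conditioning on `f` disappears under the outer expectation. -/
lemma bayesRegret_eq_sum (hrun : IsRun Pr w U k σ f ε F x P j y) (T : ℕ) :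
    bayesRegret Pr w f xs Ps x P T =
      ∑ t ∈ Finset.range T, ∫ s, instRegret w f xs Ps x P t s ∂Pr := by
  unfold bayesRegret regret
  rw [integral_finsetSum _ fun _ _ => integrable_condExp]
  exact Finset.sum_congr rfl fun t _ => integral_condExp hrun.measurable_objective.comap_le

/-- Common source of both conclusions: the finite-time bound lets `b` grow with `T`, whereas
sublinearity uses a fixed `b` and a different path bound `M`. -/
lemma bayesRegret_le (hk : (Matrix.of k).PosSemidef) (hk1 : ∀ u v, k u v ≤ 1)
    (hσ : 0 < σ) (hU : (U : Set (Fin n → ℝ)) ⊆ chiSqBall n ρ)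
    (hrun : IsRun Pr w U k σ f ε F x P j y)
    (hopt : ∀ s, IsRobustOptimal w U (fun u => f u s) (xs s) (Ps s)) {T : ℕ} {b M : ℝ}
    (hb : 0 ≤ b) (hM : ∀ s, ∑ t ∈ Finset.range T, queryStd w k σ x j t s ≤ M) :
    bayesRegret Pr w f xs Ps x P T ≤ b * M +
      T * (𝒳.card * U.card * (Real.exp (-b ^ 2 / 2) / √(2 * Real.pi))) := by
  rw [bayesRegret_eq_sum hrun]
  calc _ ≤ ∑ t ∈ Finset.range T, (b * ∫ s, queryStd w k σ x j t s ∂Pr +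
        𝒳.card * U.card * (Real.exp (-b ^ 2 / 2) / √(2 * Real.pi))) :=
        Finset.sum_le_sum fun t _ => integral_instRegret_le hk hk1 hσ hU hrun hopt t hb
    _ = b * ∫ s, ∑ t ∈ Finset.range T, queryStd w k σ x j t s ∂Pr +
        T * (𝒳.card * U.card * (Real.exp (-b ^ 2 / 2) / √(2 * Real.pi))) := by
        rw [integral_finsetSum _ fun t _ => hrun.integrable_queryStd hk hk1 hσ t,
          Finset.sum_add_distrib, Finset.mul_sum]
        simp
    _ ≤ _ := by
        gcongr
        calc _ ≤ ∫ _, M ∂Pr := integral_mono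
              (integrable_finsetSum _ fun t _ => hrun.integrable_queryStd hk hk1 hσ t)
              (integrable_const _) hM
          _ = M := by simp

/-- Along a path, the logarithms of one plus the scaled variances add up to twice the mutual
information at the queried points, which the maximum dominates. The chord bound for the logarithm
returns to the variances; it needs them to be at most one. -/
lemma sum_postCov_le (hk : (Matrix.of k).PosSemidef) (hk1 : ∀ u v, k u v ≤ 1) (hσ : 0 < σ)
    (T : ℕ) (s : S) :
    ∑ t ∈ Finset.range T, queryStd w k σ x j t s ^ 2 ≤
      2 * maxInfoGain w k σ T * (Real.log (1 + σ⁻¹ ^ 2))⁻¹ := by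
  have hlog : 0 < Real.log (1 + σ⁻¹ ^ 2) := Real.log_pos (by simp; positivity)
  set z : ℕ → Dom 𝒳 Ω := fun t => (x t s, w (j t s)) with hz
  have hq : ∀ t, queryStd w k σ x j t s ^ 2 = postCov k σ (fun i : Fin t => z i) (z t) (z t) :=
    fun t => Real.sq_sqrt (postCov_self_nonneg hk hσ _ _)
  have hI : (1 / 2) * ∑ t ∈ Finset.range T,
      Real.log (1 + σ⁻¹ ^ 2 * queryStd w k σ x j t s ^ 2) ≤ maxInfoGain w k σ T := by
    have h1 : (mutualInfo (obsLaw k σ fun i : Fin T => z i)).toReal ≤ maxInfoGain w k σ T :=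
      le_ciSup (f := fun a : Fin T → 𝒳 × Fin n =>
        (mutualInfo (obsLaw k σ fun i => ((a i).1, w (a i).2))).toReal)
        (Set.finite_range _).bddAbove (fun i => (x i s, j i s))
    rw [toReal_mutualInfo_obsLaw hk hσ, log_det_noisyGram hk hσ] at h1
    simpa only [hq, add_sub_cancel_left] using h1
  rw [← div_eq_mul_inv, le_div_iff₀ hlog, Finset.sum_mul]
  calc _ ≤ ∑ t ∈ Finset.range T, Real.log (1 + σ⁻¹ ^ 2 * queryStd w k σ x j t s ^ 2) := by
        refine Finset.sum_le_sum fun t _ => mul_log_one_add_le (sq_nonneg _) ?_ (sq_nonneg _)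
        exact pow_le_one₀ (Real.sqrt_nonneg _) (queryStd_le_one hk hk1 hσ t s)
    _ ≤ _ := by linarith

lemma sum_queryStd_le_sqrt (hk : (Matrix.of k).PosSemidef) (hk1 : ∀ u v, k u v ≤ 1) (hσ : 0 < σ)
    (T : ℕ) (s : S) :
    ∑ t ∈ Finset.range T, queryStd w k σ x j t s ≤
      √(T * (2 * maxInfoGain w k σ T * (Real.log (1 + σ⁻¹ ^ 2))⁻¹)) := by
  apply Real.le_sqrt_of_sq_le
  have h := sq_sum_le_card_mul_sum_sq (s := Finset.range T)
    (f := fun t => queryStd w k σ x j t s)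
  rw [Finset.card_range] at h
  exact h.trans (mul_le_mul_of_nonneg_left (sum_postCov_le hk hk1 hσ T s) (Nat.cast_nonneg _))

/-- Only the earlier observations at the same site are exploited; before the first of them the
kernel bound gives the value 1. -/
lemma queryStd_le_visitBound (hk : (Matrix.of k).PosSemidef) (hk1 : ∀ u v, k u v ≤ 1) (hσ : 0 < σ)
    [DecidableEq (𝒳 × Fin n)] (t : ℕ) (s : S) :
    queryStd w k σ x j t s ≤ visitBound σ
      ((Finset.range t).filter fun i => (x i s, j i s) = (x t s, j t s)).card := by
  unfold visitBound
  split_ifs with h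
  · exact queryStd_le_one hk hk1 hσ t s
  let v := (Finset.univ : Finset (Fin t)).filter fun i : Fin t => (x i s, j i s) = (x t s, j t s)
  have hv : v.card = ((Finset.range t).filter fun i => (x i s, j i s) = (x t s, j t s)).card := by
    rw [← Finset.card_map (Fin.valEmbedding (n := t))]
    congr 1
    ext i
    simp only [v, Finset.mem_map, Finset.mem_filter, Finset.mem_univ, true_and, Finset.mem_range]
    constructor
    · rintro ⟨i, hi, rfl⟩
      exact ⟨i.2, hi⟩
    · rintro ⟨h1, h2⟩
      exact ⟨⟨i, h1⟩, h2, rfl⟩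
  rw [← hv] at h ⊢
  have h1 := postCov_self_le_div hk hσ (queries w x j t s) (x t s, w (j t s)) v
    (Finset.card_ne_zero.1 h) fun i hi => by
      have hi := (Finset.mem_filter.1 hi).2
      simp only [Prod.mk.injEq] at hi
      simp [queries, hi.1, hi.2]
  calc _ ≤ √(σ ^ 2 / v.card) := Real.sqrt_le_sqrt h1
    _ = _ := by rw [Real.sqrt_div (sq_nonneg σ), Real.sqrt_sq hσ.le]

lemma sum_queryStd_le_visits (hk : (Matrix.of k).PosSemidef) (hk1 : ∀ u v, k u v ≤ 1) (hσ : 0 < σ)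
    (T : ℕ) (s : S) :
    ∑ t ∈ Finset.range T, queryStd w k σ x j t s ≤
      Fintype.card (𝒳 × Fin n) * ∑ q ∈ Finset.range T, visitBound σ q := by
  classical
  exact (Finset.sum_le_sum fun t _ => queryStd_le_visitBound hk hk1 hσ t s).trans
    (sum_visits_le (visitBound_nonneg hσ) (fun t => (x t s, j t s)) T)

/-- The regret is sublinear. -/
lemma eventually_bayesRegret_le (hk : (Matrix.of k).PosSemidef) (hk1 : ∀ u v, k u v ≤ 1)
    (hσ : 0 < σ) (hU : (U : Set (Fin n → ℝ)) ⊆ chiSqBall n ρ)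
    (hrun : IsRun Pr w U k σ f ε F x P j y)
    (hopt : ∀ s, IsRobustOptimal w U (fun u => f u s) (xs s) (Ps s)) {δ : ℝ} (hδ : 0 < δ) :
    ∀ᶠ T : ℕ in atTop, bayesRegret Pr w f xs Ps x P T ≤ δ * T := by
  have hexp : Tendsto (fun b : ℝ => 𝒳.card * U.card * (Real.exp (-b ^ 2 / 2) / √(2 * Real.pi)))
      atTop (𝓝 0) := by
    have h1 : Tendsto (fun b : ℝ => -b ^ 2 / 2) atTop atBot := by
      have : Tendsto (fun b : ℝ => b ^ 2 / 2) atTop atTop :=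
        (tendsto_pow_atTop two_ne_zero).atTop_div_const two_pos
      refine (tendsto_neg_atTop_atBot.comp this).congr fun b => ?_
      simp only [Function.comp_apply]
      ring
    simpa using ((Real.tendsto_exp_atBot.comp h1).div_const (√(2 * Real.pi))).const_mul
      ((𝒳.card : ℝ) * U.card)
  -- `b` is fixed so large that the tail term costs at most `δ / 2` per round; the remaining `δ / 2`
  -- is left for the averaged standard deviations.
  obtain ⟨b, hb0, hb⟩ := ((eventually_ge_atTop (0 : ℝ)).and
    (hexp.eventually_le_const (half_pos hδ))).exists
  -- Cesàro: the visit bounds tend to zero, hence so do their averages, even after multiplication by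
  -- the fixed `b` and the number of sites.
  have hces := ((tendsto_visitBound σ).cesaro.const_mul (b * Fintype.card (𝒳 × Fin n)))
  rw [mul_zero] at hces
  filter_upwards [hces.eventually_le_const (half_pos hδ), eventually_gt_atTop 0] with T hT hT0
  have hT0' : (0 : ℝ) < T := by exact_mod_cast hT0
  have h := bayesRegret_le hk hk1 hσ hU hrun hopt hb0 fun s =>
    sum_queryStd_le_visits (x := x) (j := j) (w := w) hk hk1 hσ T s
  have h2 : b * (Fintype.card (𝒳 × Fin n) * ∑ q ∈ Finset.range T, visitBound σ q) ≤
      T * (δ / 2) := by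
    rw [inv_mul_eq_div, mul_div_assoc', div_le_iff₀ hT0'] at hT
    linarith
  have h3 := mul_le_mul_of_nonneg_left hb hT0'.le
  linarith

/-- The finite-time bound on the Bayesian regret. -/
lemma bayesRegret_le_maxInfoGain (hk : (Matrix.of k).PosSemidef) (hk1 : ∀ u v, k u v ≤ 1)
    (hσ : 0 < σ) (hU : (U : Set (Fin n → ℝ)) ⊆ chiSqBall n ρ)
    (hrun : IsRun Pr w U k σ f ε F x P j y)
    (hopt : ∀ s, IsRobustOptimal w U (fun u => f u s) (xs s) (Ps s)) (T : ℕ) :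
    bayesRegret Pr w f xs Ps x P T ≤ 1 + 2 * √(T * maxInfoGain w k σ T *
      (Real.log (1 + σ⁻¹ ^ 2))⁻¹ *
        Real.log ((1 + (T : ℝ) ^ 2) * (𝒳.card * U.card) / √(2 * Real.pi))) := by
  obtain ⟨s₀⟩ := Pr.nonempty_of_neZero
  have hX : (0 : ℝ) < 𝒳.card := by
    exact_mod_cast Finset.card_pos.2 ⟨_, (x 0 s₀).2⟩
  have hU0 : (0 : ℝ) < U.card := by
    exact_mod_cast Finset.card_pos.2 ⟨_, (hrun.choose_x 0 s₀).mem (x 0 s₀)⟩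
  set A := (1 + (T : ℝ) ^ 2) * (𝒳.card * U.card) / √(2 * Real.pi) with hA
  have hA0 : 0 < A := by positivity
  set c := T * maxInfoGain w k σ T * (Real.log (1 + σ⁻¹ ^ 2))⁻¹ with hc
  have hlog : 0 < Real.log (1 + σ⁻¹ ^ 2) := Real.log_pos (by simp; positivity)
  have hc0 : 0 ≤ c := by
    have := maxInfoGain_nonneg w k σ T
    positivity
  -- With b = √(2 log A) the tail factor exp(-b²/2) equals 1/A when A ≥ 1, which balances the
  -- T|𝒳||U|/√(2π) tail terms.
  have h := bayesRegret_le hk hk1 hσ hU hrun hopt (Real.sqrt_nonneg (2 * Real.log A)) fun s =>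
    sum_queryStd_le_sqrt (x := x) (j := j) (w := w) hk hk1 hσ T s
  have hmain : √(2 * Real.log A) *
      √(T * (2 * maxInfoGain w k σ T * (Real.log (1 + σ⁻¹ ^ 2))⁻¹)) = 2 * √(c * Real.log A) := by
    rw [← Real.sqrt_mul' _ (by rw [show T * (2 * maxInfoGain w k σ T *
        (Real.log (1 + σ⁻¹ ^ 2))⁻¹) = 2 * c by rw [hc]; ring]; positivity),
      show 2 * Real.log A * (T * (2 * maxInfoGain w k σ T * (Real.log (1 + σ⁻¹ ^ 2))⁻¹)) =
        2 ^ 2 * (c * Real.log A) by rw [hc]; ring,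
      Real.sqrt_mul (by norm_num), Real.sqrt_sq (by norm_num)]
  have hT : (T : ℝ) ≤ 1 + (T : ℝ) ^ 2 := by nlinarith [sq_nonneg ((T : ℝ) - 1)]
  have herr : T * (𝒳.card * U.card * (Real.exp (-√(2 * Real.log A) ^ 2 / 2) /
      √(2 * Real.pi))) ≤ 1 := by
    have hTA : T * (𝒳.card * U.card) / √(2 * Real.pi) ≤ A := by
      rw [hA]
      gcongr
    -- When `A < 1` the square root is read as `0`, so the exponential is 1; but then `A` itself,
    -- which dominates the tail sum, is at most 1.
    rcases le_total 0 (Real.log A) with hL | hL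
    · rw [Real.sq_sqrt (by positivity), show -(2 * Real.log A) / 2 = -Real.log A by ring,
        Real.exp_neg, Real.exp_log hA0]
      calc _ = T * (𝒳.card * U.card) / √(2 * Real.pi) / A := by field_simp
        _ ≤ 1 := (div_le_one hA0).2 hTA
    · rw [Real.sqrt_eq_zero_of_nonpos (by linarith)]
      have : A ≤ 1 := (Real.log_nonpos_iff hA0.le).1 hL
      calc _ = T * (𝒳.card * U.card) / √(2 * Real.pi) := by simp; ring
        _ ≤ 1 := hTA.trans this
  rw [hmain] at h
  linarith

end IsRun

end DRBQO

theorem theorem2 {d m n : ℕ} (𝒳 : Finset (EuclideanSpace ℝ (Fin d)))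
    (Ω : Set (EuclideanSpace ℝ (Fin m))) (w : Fin n → Ω)
    (k : DRBQO.Dom 𝒳 Ω → DRBQO.Dom 𝒳 Ω → ℝ)
    (hk : (Matrix.of k).PosSemidef) (hk1 : ∀ u v, k u v ≤ 1)
    (σ : ℝ) (hσ : 0 < σ) (B : ℝ) (hB : 0 ≤ B) (ρ : ℝ)
    (U : Finset (Fin n → ℝ)) (hU : (U : Set (Fin n → ℝ)) ⊆ DRBQO.chiSqBall n ρ)
    {S : Type*} [MeasurableSpace S] (Pr : Measure S) [IsProbabilityMeasure Pr]
    (f : DRBQO.Dom 𝒳 Ω → S → ℝ) (ε : ℕ → S → ℝ) (F : ℕ → DRBQO.Dom 𝒳 Ω → S → ℝ)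
    (x : ℕ → S → 𝒳) (P : ℕ → S → 𝒳 → Fin n → ℝ) (j : ℕ → S → Fin n) (y : ℕ → S → ℝ)
    (hrun : DRBQO.IsRun Pr w U k σ f ε F x P j y)
    (xs : S → 𝒳) (Ps : S → 𝒳 → Fin n → ℝ)
    (hopt : ∀ s, DRBQO.IsRobustOptimal w U (fun u => f u s) (xs s) (Ps s)) :
    (∀ t, Integrable (DRBQO.instRegret w f xs Ps x P t) Pr) ∧
    (∀ T : ℕ, DRBQO.bayesRegret Pr w f xs Ps x P T ≤
      1
      + (√(2 * Real.log ((1 + (T : ℝ) ^ 2) * (𝒳.card * U.card) / √(2 * Real.pi))) + B)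
          * √(2 * Real.pi) / (𝒳.card * U.card)
      + 2 * DRBQO.maxInfoGain w k σ T * √((1 + 2 * ρ) * n) / Real.log (1 + σ⁻¹ ^ 2)
      + 2 * √(T * DRBQO.maxInfoGain w k σ T * (Real.log (1 + σ⁻¹ ^ 2))⁻¹
          * Real.log ((1 + (T : ℝ) ^ 2) * (𝒳.card * U.card) / √(2 * Real.pi)))) ∧
    (∀ δ : ℝ, 0 < δ → ∀ᶠ T : ℕ in atTop,
      DRBQO.bayesRegret Pr w f xs Ps x P T ≤ δ * T) := by
  have hlog : 0 < Real.log (1 + σ⁻¹ ^ 2) := Real.log_pos (by simp; positivity)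
  refine ⟨fun t => hrun.integrable_instRegret hU hopt t, fun T => ?_, fun δ hδ =>
    hrun.eventually_bayesRegret_le hk hk1 hσ hU hopt hδ⟩
  -- The two middle terms of the bound are nonnegative, so the sharper estimate without them
  -- suffices.
  have hγ := DRBQO.maxInfoGain_nonneg w k σ T
  have h1 : 0 ≤ (√(2 * Real.log ((1 + (T : ℝ) ^ 2) * (𝒳.card * U.card) / √(2 * Real.pi))) + B)
      * √(2 * Real.pi) / (𝒳.card * U.card) := by positivity
  have h2 : 0 ≤ 2 * DRBQO.maxInfoGain w k σ T * √((1 + 2 * ρ) * n) /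
      Real.log (1 + σ⁻¹ ^ 2) := by positivity
  have h3 := hrun.bayesRegret_le_maxInfoGain hk hk1 hσ hU hopt T
  linarith
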